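/- Let $\Gamma$ be a finitely generated group that is virtually $(\mathcal H,F)$-indicable: $\mathcal H$ is a normal subgroup of $\Gamma$ of finite index and $F:\mathcal H\to\mathbb Z$ is a surjective homomorphism. Let $\Phi$ be the set of functions $\phi:\Gamma\to[0,\infty)$ with $\phi(\mathbf 1)=0$ that are symmetric ($\phi(\gamma^{-1})=\phi(\gamma)$), summable ($\sum_{\gamma}\phi(\gamma)<\infty$), and that span $\Gamma$. Here a self-avoiding walk (SAW) is a finite sequence $\pi=(\pi_0,\dots,\pi_n)$ of distinct elements of $\Gamma$, its weight is $w_\phi(\pi)=\prod_{i=1}^n\phi(\pi_{i-1}^{-1}\pi_i)$, and $\phi$ spans $\Gamma$ if any two elements are joined by a SAW of strictly positive weight. Let $\Lambda$ be the set of functions $\ell:\Gamma\to(0,\infty)$ that are symmetric and satisfy $\inf_{\gamma}\ell(\gamma)>0$; the $\ell$-length of a SAW is $\ell(\pi)=\sum_{i=1}^n\ell(\pi_{i-1}^{-1}\pi_i)$. For $\phi\in\Phi$ and $\ell\in\Lambda$, write $w_\phi(\sigma_{m,c})$ for the sum of $w_\phi(\pi)$ over all SAWs $\pi$ with $\pi_0=\mathbf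 1$ and $m\le\ell(\pi)<m+c$. The connective constant is $$\mu_{\phi,\ell}=\limsup_{m\to\infty}w_\phi(\sigma_{m,c})^{1/m},$$ where $m$ runs through the integers; for all sufficiently large $c$ this is finite and does not depend on $c$. Let $\phi\in\Phi$, and let $K_\phi$ be the graph on $\Gamma$ in which distinct $u,v$ are adjacent if and only if $\phi(u^{-1}v)>0$. Let $(h,\mathcal H)$ be a strong graph height function on $K_\phi$: $h:\Gamma\to\mathbb Z$ satisfies $h(\mathbf 1)=0$ and $h(\alpha v)-h(\alpha u)=h(v)-h(u)$ for all $\alpha\in\mathcal H$, $u,v\in\Gamma$, and every $v\in\Gamma$ has neighbours $u,w$ in $K_\phi$ with $h(u)<h(v)<h(w)$. Let $C>0$ and $\varepsilon\in[1,2)$, and let $\ell\in\Lambda$ satisfy $$|h(u)-h(v)|\le C\,\ell(u^{-1}v)^{\varepsilon}\qquad\text{for all }u,v\in\Gamma\text{ with }\phi(u^{-1}v)>0.$$ Assume in addition that for every $K>0$ there is $\eta>0$ such that $\ell(\gamma)>K$ whenever $0<\phi(\gamma)<\eta$. For $\eta>0$, let $\phi^\eta(\gamma)=\phi(\gamma)$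 if $\phi(\gamma)\ge\eta$, and $\phi^\eta(\gamma)=0$ otherwise. Then $\phi^\eta\in\Phi$ for all sufficiently small $\eta>0$, and $$\mu_{\phi^\eta,\ell}\to\mu_{\phi,\ell}\qquad\text{as }\eta\downarrow0.$$ -/

import Mathlib

open Filter Topology
open scoped ENNReal

/-- `Γ` is virtually `(H, F)`-indicable: `H` is a normal subgroup of finite index and
`F : H → ℤ` is a surjective homomorphism (`Multiplicative ℤ` is the additive group `ℤ`). -/
structure IsVirtuallyIndicableBy {Γ : Type*} [Group Γ] (H : Subgroup Γ)
    (F : H →* Multiplicative ℤ) : Prop where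
  normal : H.Normal
  finiteIndex : H.FiniteIndex
  surjective : Function.Surjective F

/-- A self-avoiding walk, started at `v`, on the complete graph with vertex set `Γ`:
a finite sequence of distinct vertices. -/
structure SAW (Γ : Type*) (v : Γ) where
  /-- The number of steps. -/
  steps : ℕ
  /-- The vertices visited, in order. -/
  vert : Fin (steps + 1) → Γ
  start : vert 0 = v
  injective : Function.Injective vert

namespace SAW

variable {Γ : Type*} {v : Γ}

/-- The final vertex of a walk. -/
def last (π : SAW Γ v) : Γ := π.vert (Fin.last π.steps)

variable [Group Γ]

/-- The increment `π_i⁻¹ π_{i+1}` of the walk at step `i`. -/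
def incr (π : SAW Γ v) (i : Fin π.steps) : Γ := (π.vert i.castSucc)⁻¹ * π.vert i.succ

/-- The weight `w_φ(π)`: the product of the weights of the traversed edges. -/
def weight (φ : Γ → ℝ) (π : SAW Γ v) : ℝ := ∏ i, φ (π.incr i)

/-- The `ℓ`-length of a walk: the sum of the lengths of the traversed edges. -/
def length (ℓ : Γ → ℝ) (π : SAW Γ v) : ℝ := ∑ i, ℓ (π.incr i)

end SAW

/-- `φ` spans `Γ`: any two vertices are joined by a self-avoiding walk of positive weight. -/
def Spans {Γ : Type*} [Group Γ] (φ : Γ → ℝ) : Prop :=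
  ∀ u v : Γ, ∃ π : SAW Γ u, π.last = v ∧ 0 < π.weight φ

/-- The space `Φ` of weight functions on `Γ`. -/
structure IsWeightFunction {Γ : Type*} [Group Γ] (φ : Γ → ℝ) : Prop where
  nonneg : ∀ γ, 0 ≤ φ γ
  map_one : φ 1 = 0
  symm : ∀ γ, φ γ⁻¹ = φ γ
  summable : Summable φ
  spans : Spans φ

/-- The space `Λ` of length functions on `Γ`. -/
structure IsLengthFunction {Γ : Type*} [Group Γ] (ℓ : Γ → ℝ) : Prop where
  pos : ∀ γ, 0 < ℓ γ
  symm : ∀ γ, ℓ γ⁻¹ = ℓ γ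
  min_pos : 0 < ⨅ γ, ℓ γ

/-- The graph `K_φ`: the Cayley graph of `Γ` whose generators are the elements of the support
of `φ`, so that `u ≠ v` are adjacent if and only if `φ (u⁻¹ v) > 0`. -/
def supportGraph {Γ : Type*} [Group Γ] (φ : Γ → ℝ) : SimpleGraph Γ :=
  SimpleGraph.mulCayley {γ : Γ | 0 < φ γ}

/-- `(h, H)` is a strong graph height function on the Cayley graph `G` of `Γ`:
`H` is a normal subgroup of finite index, acting by left multiplication (by automorphisms
of `G`, with finitely many orbits since the index is finite), and `h` vanishes at the identity, is
`H`-difference-invariant, and every vertex has a strictly lower and a strictly higher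
neighbour. -/
structure IsStrongHeightFunction {Γ : Type*} [Group Γ] (G : SimpleGraph Γ) (H : Subgroup Γ)
    (h : Γ → ℤ) : Prop where
  normal : H.Normal
  finiteIndex : H.FiniteIndex
  map_adj : ∀ α ∈ H, ∀ u v : Γ, G.Adj (α * u) (α * v) ↔ G.Adj u v
  map_one : h 1 = 0
  diff_invariant : ∀ α ∈ H, ∀ u v : Γ, h (α * v) - h (α * u) = h v - h u
  exists_neighbours : ∀ v : Γ, ∃ u w : Γ, G.Adj v u ∧ G.Adj v w ∧ h u < h v ∧ h v < h w

/-- The space `Λ_ε(C, φ)` of length functions satisfying the Hölder condition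
`|h(u) - h(v)| ≤ C ℓ(u⁻¹ v)^ε` whenever `φ(u⁻¹ v) > 0`. -/
structure IsHolderLengthFunction {Γ : Type*} [Group Γ] (h : Γ → ℤ) (ε C : ℝ) (φ : Γ → ℝ)
    (ℓ : Γ → ℝ) : Prop where
  isLengthFunction : IsLengthFunction ℓ
  holder : ∀ u v : Γ, 0 < φ (u⁻¹ * v) → |(h u : ℝ) - (h v : ℝ)| ≤ C * ℓ (u⁻¹ * v) ^ ε

/-- The total weight `w_φ(σ_{m,c})` of the self-avoiding walks from the identity whose
`ℓ`-length lies in `[m, m + c)`. -/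
noncomputable def sawWeight {Γ : Type*} [Group Γ] (φ ℓ : Γ → ℝ) (m c : ℝ) : ℝ≥0∞ :=
  ∑' π : {π : SAW Γ (1 : Γ) // m ≤ π.length ℓ ∧ π.length ℓ < m + c},
    ENNReal.ofReal (π.1.weight φ)

/-- `μ` is the connective constant `μ_{φ,ℓ}`: for all sufficiently large `c`, the limit superior
of `w_φ(σ_{m,c})^{1/m}`, as `m → ∞` through the integers, equals `μ`. -/
def IsConnectiveConstant {Γ : Type*} [Group Γ] (φ ℓ : Γ → ℝ) (μ : ℝ) : Prop :=
  0 ≤ μ ∧ ∀ᶠ c : ℝ in atTop,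
    limsup (fun m : ℕ => sawWeight φ ℓ m c ^ (1 / (m : ℝ))) atTop = ENNReal.ofReal μ

open Classical in
/-- The truncated weight function `φ^η`. -/
noncomputable def truncate {Γ : Type*} (φ : Γ → ℝ) (η : ℝ) (γ : Γ) : ℝ :=
  if η ≤ φ γ then φ γ else 0

/-- The pair `(φ, ℓ)` is continuous at `0`: `ℓ(γ) → ∞` as `φ(γ) → 0` with `φ(γ) > 0`. -/
def ContinuousAtZero {Γ : Type*} (φ ℓ : Γ → ℝ) : Prop :=
  ∀ K : ℝ, 0 < K → ∃ η : ℝ, 0 < η ∧ ∀ γ : Γ, 0 < φ γ → φ γ < η → K < ℓ γ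

/-! ### Walks as lists of increments -/

/-! The connective constant is the reciprocal of the radius of convergence of the generating
function `sawSeries φ ℓ x`, the sum of w(π) x^ℓ(π) over SAWs from the identity. Truncation lowers
weights, so the constants of φ^η are at most that of φ and increase as η ↓ 0; the issue is to
exclude a limit that is too small.

Suppose the constants of φ^η all stay below some b < μ. Then their series are all finite at x = 1/b.
Bridges whose ends have the same class in the finite group Γ/H can be concatenated, so a class of
them with a fixed number n of steps has weight at most 1: otherwise its powers would make the series
diverge. This bound does not depend on η, so it passes to φ itself, because any finite family of
walks is unaffected by small truncations (`totalWeight_bridgesTo_le_of_truncate`). Different end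
classes cost only a constant.

At y < x every step gains a fixed factor less than 1, since ℓ is bounded below. Hence the bridges of
φ are summable over n at y. The Hammersley–Welsh argument then bounds half-space walks by a product
over bridge spans, and all SAWs by pairs of half-space walks (`sawSeries_ne_top_of_truncate`). So
the series of φ is finite at every y < 1/b, which forces μ ≤ b, a contradiction. -/

namespace IncrementList

section Walk

variable {Γ : Type*} [Group Γ]

/-- The vertex reached after `i` steps by the walk from `v` with increments `l`. -/
def vertex (v : Γ) (l : List Γ) (i : ℕ) : Γ := v * (l.take i).prod

/-- The walk with increments `l` is self-avoiding. -/
def SelfAvoiding (l : List Γ) : Prop :=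
  ∀ i j, i < j → j ≤ l.length → (l.take i).prod ≠ (l.take j).prod

@[simp] lemma vertex_zero (v : Γ) (l : List Γ) : vertex v l 0 = v := by simp [vertex]

@[simp] lemma vertex_length (v : Γ) (l : List Γ) : vertex v l l.length = v * l.prod := by
  simp [vertex]

lemma vertex_append_left (v : Γ) (a b : List Γ) {i : ℕ} (hi : i ≤ a.length) :
    vertex v (a ++ b) i = vertex v a i := by
  simp [vertex, List.take_append_of_le_length hi]

lemma vertex_append_right (v : Γ) (a b : List Γ) (i : ℕ) :
    vertex v (a ++ b) (a.length + i) = vertex (v * a.prod) b i := by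
  simp [vertex, List.take_length_add_append, mul_assoc]

lemma vertex_append_right' (v : Γ) (a b : List Γ) {i : ℕ} (hi : a.length ≤ i) :
    vertex v (a ++ b) i = vertex (v * a.prod) b (i - a.length) := by
  rw [← vertex_append_right, Nat.add_sub_cancel' hi]

@[simp] lemma vertex_cons_succ (v g : Γ) (l : List Γ) (i : ℕ) :
    vertex v (g :: l) (i + 1) = vertex (v * g) l i := by
  simp [vertex, mul_assoc]

lemma vertex_take (v : Γ) (l : List Γ) {i n : ℕ} (hi : i ≤ n) :
    vertex v (l.take n) i = vertex v l i := by
  simp [vertex, List.take_take, hi]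

lemma vertex_drop (v : Γ) (l : List Γ) (n i : ℕ) :
    vertex (vertex v l n) (l.drop n) i = vertex v l (n + i) := by
  simp [vertex, List.take_add, mul_assoc]

lemma selfAvoiding_iff (v : Γ) (l : List Γ) :
    SelfAvoiding l ↔ ∀ i j, i < j → j ≤ l.length → vertex v l i ≠ vertex v l j := by
  simp [SelfAvoiding, vertex]

lemma selfAvoiding_nil : SelfAvoiding ([] : List Γ) := by
  intro i j hij hj
  simp at hj
  omega

lemma SelfAvoiding.take {l : List Γ} (hl : SelfAvoiding l) (n : ℕ) : SelfAvoiding (l.take n) := by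
  rw [selfAvoiding_iff 1] at hl ⊢
  intro i j hij hj
  rw [List.length_take] at hj
  rw [vertex_take _ _ (by omega), vertex_take _ _ (by omega)]
  exact hl i j hij (by omega)

lemma SelfAvoiding.drop {l : List Γ} (hl : SelfAvoiding l) (n : ℕ) : SelfAvoiding (l.drop n) := by
  rw [selfAvoiding_iff 1] at hl
  rw [selfAvoiding_iff (vertex 1 l n)]
  intro i j hij hj
  rw [List.length_drop] at hj
  rw [vertex_drop, vertex_drop]
  exact hl _ _ (by omega) (by omega)

/-- Two self-avoiding walks whose vertex sets only share the joining vertex concatenate to a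
self-avoiding walk. -/
lemma SelfAvoiding.append {a b : List Γ} (ha : SelfAvoiding a) (hb : SelfAvoiding b) (v : Γ)
    (hab : ∀ i j, i ≤ a.length → 0 < j → j ≤ b.length →
      vertex v a i ≠ vertex (v * a.prod) b j) : SelfAvoiding (a ++ b) := by
  rw [selfAvoiding_iff v] at ha ⊢
  rw [selfAvoiding_iff (v * a.prod)] at hb
  intro i j hij hj
  rw [List.length_append] at hj
  rcases le_or_gt j a.length with h1 | h1
  · rw [vertex_append_left _ _ _ h1, vertex_append_left _ _ _ (by omega)]
    exact ha i j hij h1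
  · rw [vertex_append_right' _ _ _ h1.le]
    rcases le_or_gt i a.length with h2 | h2
    · rw [vertex_append_left _ _ _ h2]
      exact hab _ _ h2 (by omega) (by omega)
    · rw [vertex_append_right' _ _ _ h2.le]
      exact hb _ _ (by omega) (by omega)

/-- Loop erasure. -/
lemma exists_selfAvoiding (P : Γ → Prop) (v : Γ) (l : List Γ) (hl : ∀ g ∈ l, P g) :
    ∃ l' : List Γ, SelfAvoiding l' ∧ (∀ g ∈ l', P g) ∧ l'.prod = l.prod ∧
      ∀ i, 0 < i → i ≤ l'.length → ∃ j, 0 < j ∧ j ≤ l.length ∧ vertex v l' i = vertex v l j := by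
  induction hn : l.length using Nat.strong_induction_on generalizing l with
  | _ n ih =>
    subst hn
    by_cases hs : SelfAvoiding l
    · exact ⟨l, hs, hl, rfl, fun i h0 hi => ⟨i, h0, hi, rfl⟩⟩
    rw [selfAvoiding_iff v] at hs
    push Not at hs
    -- Cutting out the loop between the equal vertices at times `i` and `j` keeps both ends and
    -- creates no new vertex. Positive times are matched with positive times because bridges are
    -- constrained strictly only after their start.
    obtain ⟨i, j, hij, hj, he⟩ := hs
    have hlen : (l.take i ++ l.drop j).length = i + (l.length - j) := by
      simp; omega
    have hti : (l.take i).length = i := by simp; omega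
    have hv : v * (l.take i).prod = vertex v l j := he
    obtain ⟨l', h1, h2, h3, h4⟩ := ih (l.take i ++ l.drop j).length (by omega)
      (l.take i ++ l.drop j) (by
        intro g hg
        rcases List.mem_append.1 hg with h | h
        · exact hl g (List.mem_of_mem_take h)
        · exact hl g (List.mem_of_mem_drop h)) rfl
    refine ⟨l', h1, h2, ?_, ?_⟩
    · rw [h3, List.prod_append]
      have : (l.take i).prod = (l.take j).prod := by simpa [vertex] using he
      rw [this, ← List.prod_append, List.take_append_drop]
    · intro m h0 hm
      obtain ⟨k, hk0, hk, e⟩ := h4 m h0 hm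
      rcases le_or_gt k i with hki | hki
      · exact ⟨k, hk0, by omega, by
          rw [e, vertex_append_left _ _ _ (by omega), vertex_take _ _ hki]⟩
      · refine ⟨j + (k - i), by omega, by omega, ?_⟩
        rw [e, vertex_append_right' _ _ _ (by omega), hti, hv, vertex_drop]

end Walk

/-! ### Generating functions -/

section Weight

variable {Γ : Type*}

/-- The multiplicative weight of a list of increments. -/
noncomputable def listWeight (f : Γ → ℝ≥0∞) (l : List Γ) : ℝ≥0∞ := (l.map f).prod

/-- The total weight of a set of lists of increments. -/
noncomputable def totalWeight (f : Γ → ℝ≥0∞) (A : Set (List Γ)) : ℝ≥0∞ :=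
  ∑' l, A.indicator (listWeight f) l

@[simp] lemma listWeight_nil (f : Γ → ℝ≥0∞) : listWeight f [] = 1 := by simp [listWeight]

@[simp] lemma listWeight_cons (f : Γ → ℝ≥0∞) (g : Γ) (l : List Γ) :
    listWeight f (g :: l) = f g * listWeight f l := by simp [listWeight]

@[simp] lemma listWeight_append (f : Γ → ℝ≥0∞) (a b : List Γ) :
    listWeight f (a ++ b) = listWeight f a * listWeight f b := by simp [listWeight]

lemma totalWeight_eq_tsum_subtype (f : Γ → ℝ≥0∞) (A : Set (List Γ)) :
    totalWeight f A = ∑' l : A, listWeight f l := (tsum_subtype A _).symm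

lemma totalWeight_mono_set (f : Γ → ℝ≥0∞) {A B : Set (List Γ)} (h : A ⊆ B) :
    totalWeight f A ≤ totalWeight f B :=
  ENNReal.tsum_le_tsum fun l => Set.indicator_le_indicator_of_subset h (fun _ => zero_le) l

lemma totalWeight_union_le (f : Γ → ℝ≥0∞) (A B : Set (List Γ)) :
    totalWeight f (A ∪ B) ≤ totalWeight f A + totalWeight f B := by
  simp only [totalWeight_eq_tsum_subtype]
  exact ENNReal.tsum_union_le _ _ _

@[simp] lemma totalWeight_singleton (f : Γ → ℝ≥0∞) (a : List Γ) :
    totalWeight f {a} = listWeight f a := by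
  rw [totalWeight_eq_tsum_subtype, tsum_singleton]

/-- Sets of lists that can be split into a prefix in `A` and a suffix in `B a`. -/
lemma totalWeight_le_mul (f : Γ → ℝ≥0∞) (C A : Set (List Γ)) (B : List Γ → Set (List Γ))
    (N : ℝ≥0∞) (hC : ∀ l ∈ C, ∃ n, l.take n ∈ A ∧ l.drop n ∈ B (l.take n))
    (hN : ∀ a ∈ A, totalWeight f (B a) ≤ N) : totalWeight f C ≤ totalWeight f A * N := by
  choose! n hn using hC
  let e : C → Σ a : A, B a.1 := fun l =>
    ⟨⟨l.1.take (n l.1), (hn l.1 l.2).1⟩, ⟨l.1.drop (n l.1), (hn l.1 l.2).2⟩⟩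
  let d : (Σ a : A, B a.1) → List Γ := fun p => p.1.1 ++ p.2.1
  have hde : ∀ l : C, d (e l) = l.1 := fun l => List.take_append_drop _ _
  have he : Function.Injective e := fun l l' h => by
    apply Subtype.ext
    rw [← hde, ← hde, h]
  calc totalWeight f C = ∑' l : C, listWeight f (d (e l)) := by
        rw [totalWeight_eq_tsum_subtype]; simp only [hde]
    _ ≤ ∑' p, listWeight f (d p) :=
        ENNReal.tsum_comp_le_tsum_of_injective he fun p => listWeight f (d p)
    _ = ∑' a : A, ∑' b : B a.1, listWeight f a.1 * listWeight f b.1 := by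
        rw [ENNReal.tsum_sigma']; simp [d]
    _ = ∑' a : A, listWeight f a.1 * totalWeight f (B a.1) := by
        simp only [ENNReal.tsum_mul_left, totalWeight_eq_tsum_subtype]
    _ ≤ ∑' a : A, listWeight f a.1 * N :=
        ENNReal.tsum_le_tsum fun a => mul_le_mul_right (hN a.1 a.2) _
    _ = totalWeight f A * N := by
        rw [ENNReal.tsum_mul_right, totalWeight_eq_tsum_subtype]

/-- Concatenation with a prefix of fixed length is injective. -/
lemma mul_totalWeight_le (f : Γ → ℝ≥0∞) (A C : Set (List Γ)) (B : List Γ → Set (List Γ))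
    (N : ℝ≥0∞) (n : ℕ) (hA : ∀ a ∈ A, a.length = n) (hN : ∀ a ∈ A, N ≤ totalWeight f (B a))
    (hC : ∀ a ∈ A, ∀ b ∈ B a, a ++ b ∈ C) : totalWeight f A * N ≤ totalWeight f C := by
  let d : (Σ a : A, B a.1) → C := fun p => ⟨p.1.1 ++ p.2.1, hC _ p.1.2 _ p.2.2⟩
  have hd : Function.Injective d := by
    rintro ⟨⟨a, ha⟩, b, hb⟩ ⟨⟨a', ha'⟩, b', hb'⟩ h
    have h : a ++ b = a' ++ b' := congrArg Subtype.val h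
    obtain ⟨rfl, rfl⟩ := List.append_inj h ((hA a ha).trans (hA a' ha').symm)
    rfl
  calc totalWeight f A * N = ∑' a : A, listWeight f a.1 * N := by
        rw [ENNReal.tsum_mul_right, totalWeight_eq_tsum_subtype]
    _ ≤ ∑' a : A, listWeight f a.1 * totalWeight f (B a.1) :=
        ENNReal.tsum_le_tsum fun a => mul_le_mul_right (hN a.1 a.2) _
    _ = ∑' a : A, ∑' b : B a.1, listWeight f a.1 * listWeight f b.1 := by
        simp only [ENNReal.tsum_mul_left, totalWeight_eq_tsum_subtype]
    _ = ∑' p, listWeight f (d p).1 := by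
        rw [ENNReal.tsum_sigma']; simp [d]
    _ ≤ ∑' l : C, listWeight f l.1 :=
        ENNReal.tsum_comp_le_tsum_of_injective hd fun l => listWeight f l.1
    _ = totalWeight f C := (totalWeight_eq_tsum_subtype _ _).symm

/-- A set of lists has total weight the sum over the values of a statistic. -/
lemma tsum_totalWeight_fiber {β : Type*} (f : Γ → ℝ≥0∞) (A : Set (List Γ)) (p : List Γ → β) :
    ∑' t, totalWeight f {l | l ∈ A ∧ p l = t} = totalWeight f A := by
  classical
  unfold totalWeight
  rw [ENNReal.tsum_comm]
  refine tsum_congr fun l => ?_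
  rw [tsum_eq_single (p l)]
  · by_cases h : l ∈ A <;> simp [Set.indicator, h]
  · intro t ht
    simp [Set.indicator, ht.symm]

/-- A total weight is at most `N` as soon as all its finite pieces are. -/
lemma totalWeight_le_of_finset (f : Γ → ℝ≥0∞) (A : Set (List Γ)) (N : ℝ≥0∞)
    (h : ∀ s : Finset (List Γ), ∑ l ∈ s, A.indicator (listWeight f) l ≤ N) :
    totalWeight f A ≤ N := by
  rw [totalWeight, ENNReal.tsum_eq_iSup_sum]
  exact iSup_le h

end Weight

end IncrementList

/-! ### Height functions and bridges -/

namespace IncrementList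

section Bridge

variable {Γ Q : Type*} [Group Γ] [Group Q] {h : Γ → ℤ} {q : Γ →* Q}

/-- Height differences along a walk only depend on the type `q v` of its initial vertex `v`. -/
def IsTypedHeight (h : Γ → ℤ) (q : Γ →* Q) : Prop :=
  ∀ v w, q v = q w → ∀ g, h (v * g) - h v = h (w * g) - h w

/-- Downward walks are treated as upward walks for `-h`. -/
lemma IsTypedHeight.neg (hq : IsTypedHeight h q) : IsTypedHeight (-h) q := by
  intro v w hvw g
  have := hq v w hvw g
  simp only [Pi.neg_apply]
  omega

lemma IsTypedHeight.vertex (hq : IsTypedHeight h q) {v w : Γ} (hvw : q v = q w) (l : List Γ)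
    (i : ℕ) : h (vertex v l i) - h v = h (IncrementList.vertex w l i) - h w :=
  hq v w hvw _

/-- After its start, a bridge stays strictly above its start and weakly below its end. -/
def IsBridge (h : Γ → ℤ) (v : Γ) (l : List Γ) : Prop :=
  SelfAvoiding l ∧ ∀ i, 0 < i → i ≤ l.length →
    h v < h (vertex v l i) ∧ h (vertex v l i) ≤ h (v * l.prod)

lemma IsBridge.congr (hq : IsTypedHeight h q) {v w : Γ} (hvw : q v = q w) {l : List Γ}
    (hl : IsBridge h v l) : IsBridge h w l := by
  refine ⟨hl.1, fun i h0 hi => ?_⟩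
  have := hl.2 i h0 hi
  have h1 := hq.vertex hvw l i
  have h2 := hq v w hvw l.prod
  omega

lemma IsBridge.le (v : Γ) {l : List Γ} (hl : IsBridge h v l) : h v ≤ h (v * l.prod) := by
  rcases Nat.eq_zero_or_pos l.length with h0 | h0
  · simp [List.length_eq_zero_iff.1 h0]
  · exact ((hl.2 _ h0 le_rfl).1.trans_le (hl.2 _ h0 le_rfl).2).le

lemma IsBridge.vertex_le {v : Γ} {l : List Γ} (hl : IsBridge h v l) {i : ℕ} (hi : i ≤ l.length) :
    h (vertex v l i) ≤ h (v * l.prod) := by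
  rcases Nat.eq_zero_or_pos i with rfl | h0
  · simpa using hl.le
  · exact (hl.2 i h0 hi).2

lemma isBridge_nil (v : Γ) : IsBridge h v [] :=
  ⟨selfAvoiding_nil, fun i h0 hi => by simp at hi; omega⟩

/-- The first bridge stays at or below the joining height and the second lies strictly above it
after its start, so they cannot collide. -/
lemma IsBridge.append {v : Γ} {a b : List Γ} (ha : IsBridge h v a)
    (hb : IsBridge h (v * a.prod) b) : IsBridge h v (a ++ b) := by
  refine ⟨ha.1.append hb.1 v fun i j hi h0 hj e => ?_, fun i h0 hi => ?_⟩
  · have h1 := ha.vertex_le hi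
    have h2 := (hb.2 j h0 hj).1
    rw [e] at h1
    omega
  · rw [List.length_append] at hi
    rw [List.prod_append, ← mul_assoc]
    rcases le_or_gt i a.length with h1 | h1
    · rw [vertex_append_left _ _ _ h1]
      exact ⟨(ha.2 i h0 h1).1, (ha.2 i h0 h1).2.trans hb.le⟩
    · rw [vertex_append_right' _ _ _ h1.le]
      have := hb.2 (i - a.length) (by omega) (by omega)
      exact ⟨ha.le.trans_lt this.1, this.2⟩

/-! ### Existence of bridges -/

lemma exists_ascending (P : Γ → Prop) (hup : ∀ v, ∃ g, P g ∧ h v < h (v * g)) (k : ℕ) (v : Γ) :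
    ∃ l : List Γ, (∀ g ∈ l, P g) ∧ h v + k ≤ h (v * l.prod) ∧
      ∀ i ≤ l.length, (0 < i → h v < h (vertex v l i)) ∧ h (vertex v l i) ≤ h (v * l.prod) := by
  induction k generalizing v with
  | zero => exact ⟨[], by simp, by simp, fun i hi => by simp at hi; subst hi; simp⟩
  | succ k ih =>
    obtain ⟨g, hg, hlt⟩ := hup v
    obtain ⟨l, hP, hk, hl⟩ := ih (v * g)
    refine ⟨g :: l, by simpa using ⟨hg, hP⟩, ?_, fun i hi => ?_⟩
    · rw [List.prod_cons, ← mul_assoc]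
      push_cast
      omega
    · rw [List.prod_cons, ← mul_assoc]
      cases i with
      | zero => simp; omega
      | succ i =>
        rw [vertex_cons_succ]
        have := hl i (by simpa using hi)
        refine ⟨fun _ => ?_, this.2⟩
        rcases Nat.eq_zero_or_pos i with rfl | h0
        · simpa
        · exact hlt.trans (this.1 h0)

/-- The path is built backwards from its end by prepending rising steps. A weak lower bound
suffices, as it is used only well above the start of the bridge under construction. -/
lemma exists_ascending_to (P : Γ → Prop) (hdown : ∀ v, ∃ g, P g ∧ h (v * g⁻¹) < h v) (k : ℕ)
    (v : Γ) : ∃ (u : Γ) (l : List Γ), (∀ g ∈ l, P g) ∧ u * l.prod = v ∧ h u + k ≤ h v ∧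
      ∀ i ≤ l.length, h u ≤ h (vertex u l i) ∧ h (vertex u l i) ≤ h v := by
  induction k with
  | zero => exact ⟨v, [], by simp, by simp, by simp, fun i hi => by simp at hi; subst hi; simp⟩
  | succ k ih =>
    obtain ⟨u, l, hP, rfl, hk, hl⟩ := ih
    obtain ⟨g, hg, hlt⟩ := hdown u
    refine ⟨u * g⁻¹, g :: l, by simpa using ⟨hg, hP⟩, by simp [← mul_assoc], ?_, fun i hi => ?_⟩
    · push_cast
      omega
    · cases i with
      | zero => simp; omega
      | succ i =>
        have := hl i (by simpa using hi)
        rw [vertex_cons_succ, inv_mul_cancel_right]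
        omega

/-- One path is fixed for each of the finitely many pairs of types and reused at every vertex.
Relative heights depend only on the type of the start, so a single `D` bounds all excursions; the
price is that only the type of `v` is reached. -/
lemma exists_bounded_connection [Finite Q] (hq : IsTypedHeight h q)
    (hsurj : Function.Surjective q) (P : Γ → Prop)
    (hconn : ∀ u v : Γ, ∃ l : List Γ, (∀ g ∈ l, P g) ∧ u * l.prod = v) :
    ∃ D : ℕ, ∀ u v : Γ, ∃ l : List Γ, (∀ g ∈ l, P g) ∧ q (u * l.prod) = q v ∧
      ∀ i ≤ l.length, |h (vertex u l i) - h u| ≤ D := by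
  cases nonempty_fintype Q
  choose r hr using hsurj
  choose L hLP hL using fun s t : Q => hconn (r s) (r t)
  let d : Q → Q → ℕ := fun s t =>
    ∑ i ∈ Finset.range ((L s t).length + 1), (h (vertex (r s) (L s t) i) - h (r s)).natAbs
  refine ⟨∑ s, ∑ t, d s t, fun u v => ⟨L (q u) (q v), hLP _ _, ?_, fun i hi => ?_⟩⟩
  · have := congrArg q (hL (q u) (q v))
    rw [map_mul, hr, hr] at this
    rw [map_mul, this]
  · rw [hq.vertex (hr (q u)).symm]
    have h1 : (h (vertex (r (q u)) (L (q u) (q v)) i) - h (r (q u))).natAbs ≤ d (q u) (q v) :=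
      Finset.single_le_sum
        (f := fun i => (h (vertex (r (q u)) (L (q u) (q v)) i) - h (r (q u))).natAbs)
        (fun _ _ => Nat.zero_le _) (Finset.mem_range.2 (by omega))
    have h2 : d (q u) (q v) ≤ ∑ t, d (q u) t :=
      Finset.single_le_sum (f := fun t => d (q u) t) (fun _ _ => Nat.zero_le _)
        (Finset.mem_univ _)
    have h3 : ∑ t, d (q u) t ≤ ∑ s, ∑ t, d s t :=
      Finset.single_le_sum (f := fun s => ∑ t, d s t) (fun _ _ => Nat.zero_le _)
        (Finset.mem_univ _)
    rw [Int.abs_eq_natAbs]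
    exact_mod_cast h1.trans (h2.trans h3)

/-- Any vertex is joined by a bridge to some vertex of any given type. -/
lemma exists_isBridge [Finite Q] (hq : IsTypedHeight h q) (hsurj : Function.Surjective q)
    (P : Γ → Prop) (hconn : ∀ u v : Γ, ∃ l : List Γ, (∀ g ∈ l, P g) ∧ u * l.prod = v)
    (hup : ∀ v, ∃ g, P g ∧ h v < h (v * g)) (hdown : ∀ v, ∃ g, P g ∧ h (v * g⁻¹) < h v)
    (w v : Γ) : ∃ l : List Γ, (∀ g ∈ l, P g) ∧ IsBridge h w l ∧ q (w * l.prod) = q v := by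
  obtain ⟨D, hD⟩ := exists_bounded_connection hq hsurj P hconn
  -- The connecting path `b` moves within `D` of the top of `a`. Climbing by `2 * D + 1` beforehand
  -- keeps it above `w`; climbing as much afterwards lifts the end above everything visited, even if
  -- `b` ends `D` lower than it began.
  obtain ⟨a, haP, hak, ha⟩ := exists_ascending P hup (2 * D + 1) w
  obtain ⟨u, c, hcP, huc, hck, hc⟩ := exists_ascending_to P hdown (2 * D + 1) v
  obtain ⟨b, hbP, hqb, hb⟩ := hD (w * a.prod) u
  have hb1 : |h (w * a.prod * b.prod) - h (w * a.prod)| ≤ D := by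
    simpa using hb b.length le_rfl
  have hend : h (w * a.prod * b.prod * c.prod) - h (w * a.prod * b.prod) = h v - h u := by
    rw [hq _ _ hqb, huc]
  rw [abs_le] at hb1
  push_cast at hak hck
  have key : ∀ i, 0 < i → i ≤ (a ++ b ++ c).length →
      h w < h (vertex w (a ++ b ++ c) i) ∧
        h (vertex w (a ++ b ++ c) i) ≤ h (w * (a ++ b ++ c).prod) := by
    intro i h0 hi
    simp only [List.prod_append, ← mul_assoc]
    rw [List.length_append, List.length_append] at hi
    rcases le_or_gt i a.length with h1 | h1
    · rw [List.append_assoc, vertex_append_left _ _ _ h1]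
      have := ha i h1
      exact ⟨this.1 h0, by omega⟩
    rcases le_or_gt i (a ++ b).length with h2 | h2
    · rw [vertex_append_left _ _ _ h2, vertex_append_right' _ _ _ h1.le]
      rw [List.length_append] at h2
      have := hb (i - a.length) (by omega)
      rw [abs_le] at this
      omega
    · rw [vertex_append_right' _ _ _ h2.le]
      simp only [List.prod_append, ← mul_assoc]
      have h3 := hc (i - (a ++ b).length) (by rw [List.length_append]; omega)
      have h4 := hq.vertex hqb c (i - (a ++ b).length)
      omega
  obtain ⟨l, hs, hlP, hprod, hl⟩ := exists_selfAvoiding P w (a ++ b ++ c) (by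
    intro g hg
    simp only [List.mem_append] at hg
    rcases hg with (hg | hg) | hg
    exacts [haP g hg, hbP g hg, hcP g hg])
  refine ⟨l, hlP, ⟨hs, fun i h0 hi => ?_⟩, ?_⟩
  · obtain ⟨j, hj0, hj, e⟩ := hl i h0 hi
    rw [e, hprod]
    exact key j hj0 hj
  · rw [hprod]
    simp only [List.prod_append, ← mul_assoc]
    rw [map_mul, hqb, ← map_mul, huc]

/-! ### Supermultiplicativity of bridges -/

/-- The bridges from `v` with `n` steps that end at a vertex of the type of `w`. -/
def bridgesTo (h : Γ → ℤ) (q : Γ →* Q) (v w : Γ) (n : ℕ) : Set (List Γ) :=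
  {l | IsBridge h v l ∧ l.length = n ∧ q (v * l.prod) = q w}

/-- Equality of types lets the second bridge start where the first one ends, and the fixed number of
steps makes concatenation injective. -/
lemma totalWeight_bridgesTo_mul_le (hq : IsTypedHeight h q) (f : Γ → ℝ≥0∞) (u v w : Γ)
    (m n : ℕ) : totalWeight f (bridgesTo h q u v m) * totalWeight f (bridgesTo h q v w n) ≤
      totalWeight f (bridgesTo h q u w (m + n)) := by
  refine mul_totalWeight_le f _ _ (fun _ => bridgesTo h q v w n) _ m (fun a ha => ha.2.1)
    (fun a _ => le_rfl) fun a ha b hb => ⟨ha.1.append (hb.1.congr hq ha.2.2.symm), ?_, ?_⟩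
  · rw [List.length_append, ha.2.1, hb.2.1]
  · rw [List.prod_append, ← mul_assoc, map_mul, ha.2.2, ← map_mul, hb.2.2]

lemma totalWeight_bridgesTo_pow_le (hq : IsTypedHeight h q) (f : Γ → ℝ≥0∞) (v : Γ) (n k : ℕ) :
    totalWeight f (bridgesTo h q v v n) ^ k ≤ totalWeight f (bridgesTo h q v v (k * n)) := by
  induction k with
  | zero =>
    rw [pow_zero, ← listWeight_nil f, ← totalWeight_singleton]
    refine totalWeight_mono_set f ?_
    rintro _ rfl
    exact ⟨isBridge_nil v, by simp, by simp⟩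
  | succ k ih =>
    rw [pow_succ, Nat.succ_mul]
    exact (mul_le_mul_left ih _).trans (totalWeight_bridgesTo_mul_le hq f v v v _ _)

/-- If the generating function of self-avoiding walks is finite, then the bridges with a given
number of steps from a vertex to its own type have total weight at most one. -/
lemma totalWeight_bridgesTo_self_le_one (hq : IsTypedHeight h q) (f : Γ → ℝ≥0∞)
    (hf : totalWeight f {l | SelfAvoiding l} ≠ ∞) (v : Γ) (n : ℕ) :
    totalWeight f (bridgesTo h q v v n) ≤ 1 := by
  by_contra! hlt
  have h1 := ENNReal.tendsto_pow_atTop_nhds_top_iff.2 hlt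
  obtain ⟨k, hk⟩ := (Tendsto.eventually_const_lt hf.lt_top h1).exists
  exact (hk.trans_le ((totalWeight_bridgesTo_pow_le hq f v n k).trans
    (totalWeight_mono_set f fun l hl => hl.1.1))).false

/-- Appending the fixed bridge `b` returns to the type of `v`, where the weight is at most one. The
resulting bound is independent of `n`. -/
lemma totalWeight_bridgesTo_le (hq : IsTypedHeight h q) (f : Γ → ℝ≥0∞)
    (hf : totalWeight f {l | SelfAvoiding l} ≠ ∞) (v w : Γ) (n : ℕ) (b : List Γ)
    (hb : IsBridge h w b) (hbv : q (w * b.prod) = q v) :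
    totalWeight f (bridgesTo h q v w n) ≤ (listWeight f b)⁻¹ := by
  rw [ENNReal.le_inv_iff_mul_le]
  calc _ ≤ totalWeight f (bridgesTo h q v w n) *
        totalWeight f (bridgesTo h q w v b.length) := by
        refine mul_le_mul_right ?_ _
        rw [← totalWeight_singleton]
        refine totalWeight_mono_set f ?_
        rintro _ rfl
        exact ⟨hb, rfl, hbv⟩
    _ ≤ _ := totalWeight_bridgesTo_mul_le hq f v w v _ _
    _ ≤ 1 := totalWeight_bridgesTo_self_le_one hq f hf v _

end Bridge

end IncrementList

/-! ### The Hammersley–Welsh decomposition -/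

namespace IncrementList

section HammersleyWelsh

variable {Γ Q : Type*} [Group Γ] [Group Q] {h : Γ → ℤ} {q : Γ →* Q}

/-- Self-avoiding walks from `v` that stay strictly above `v` after their start. -/
def halfSpace (h : Γ → ℤ) (v : Γ) : Set (List Γ) :=
  {l | SelfAvoiding l ∧ ∀ i, 0 < i → i ≤ l.length → h v < h (vertex v l i)}

/-- Half-space walks that reach relative height at most `T`. -/
def halfSpaceLE (h : Γ → ℤ) (v : Γ) (T : ℕ) : Set (List Γ) :=
  {l | SelfAvoiding l ∧ ∀ i, 0 < i → i ≤ l.length →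
    h v < h (vertex v l i) ∧ h (vertex v l i) ≤ h v + T}

/-- Bridges from `v` of span `T`. -/
def bridgesOfSpan (h : Γ → ℤ) (v : Γ) (T : ℕ) : Set (List Γ) :=
  {l | IsBridge h v l ∧ h (v * l.prod) = h v + T}

/-- Self-avoiding walks from `v` that stay weakly above `v`. -/
def weakHalfSpace (h : Γ → ℤ) (v : Γ) : Set (List Γ) :=
  {l | SelfAvoiding l ∧ ∀ i ≤ l.length, h v ≤ h (vertex v l i)}

lemma totalWeight_halfSpaceLE_zero (f : Γ → ℝ≥0∞) (v : Γ) :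
    totalWeight f (halfSpaceLE h v 0) ≤ 1 := by
  rw [← listWeight_nil f, ← totalWeight_singleton]
  refine totalWeight_mono_set f fun l hl => ?_
  rw [Set.mem_singleton_iff, ← List.length_eq_zero_iff]
  by_contra h0
  have := hl.2 1 one_pos (by omega)
  simp only [Nat.cast_zero] at this
  omega

/-- A half-space walk of extent exactly `T + 1` splits, at the last visit to its maximal height,
into a bridge of span `T + 1` and a downward half-space walk of extent at most `T`. -/
lemma totalWeight_halfSpaceLE_succ (f : Γ → ℝ≥0∞) (D N : ℝ≥0∞) (T : ℕ) (v : Γ)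
    (hD : totalWeight f (bridgesOfSpan h v (T + 1)) ≤ D)
    (hN : totalWeight f (halfSpaceLE h v T) ≤ N)
    (hN' : ∀ u, totalWeight f (halfSpaceLE (-h) u T) ≤ N) :
    totalWeight f (halfSpaceLE h v (T + 1)) ≤ (1 + D) * N := by
  classical
  let C : Set (List Γ) := {l | l ∈ halfSpaceLE h v (T + 1) ∧
    ∃ i ≤ l.length, h (vertex v l i) = h v + (T + 1)}
  have hsub : halfSpaceLE h v (T + 1) ⊆ halfSpaceLE h v T ∪ C := by
    intro l hl
    by_cases hi : ∃ i ≤ l.length, h (vertex v l i) = h v + (T + 1)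
    · exact Or.inr ⟨hl, hi⟩
    · push Not at hi
      refine Or.inl ⟨hl.1, fun i h0 hil => ?_⟩
      have h1 := hl.2 i h0 hil
      have h2 := hi i hil
      push_cast at h1
      omega
  have hC : totalWeight f C ≤ D * N := by
    refine (totalWeight_le_mul f C (bridgesOfSpan h v (T + 1))
      (fun a => halfSpaceLE (-h) (v * a.prod) T) N ?_ (fun a _ => hN' _)).trans
      (mul_le_mul_left hD _)
    rintro l ⟨hl, i, hi, hiT⟩
    let p : ℕ → Prop := fun i => h (vertex v l i) = h v + (T + 1)
    let n := Nat.findGreatest p l.length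
    have hn : n ≤ l.length := Nat.findGreatest_le _
    have hpn : h (vertex v l n) = h v + (T + 1) := Nat.findGreatest_spec (P := p) hi hiT
    have hmax : ∀ j, n < j → j ≤ l.length → h (vertex v l j) ≠ h v + (T + 1) :=
      fun j h1 h2 => Nat.findGreatest_is_greatest (P := p) h1 h2
    have hlen : (l.take n).length = n := by simp [hn]
    have hprod : v * (l.take n).prod = vertex v l n := rfl
    have hl2 := hl.2
    push_cast at hl2
    refine ⟨n, ⟨⟨hl.1.take n, fun j h0 hj => ?_⟩, ?_⟩, hl.1.drop n, fun j h0 hj => ?_⟩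
    · rw [hlen] at hj
      rw [vertex_take _ _ hj, hprod, hpn]
      exact hl2 j h0 (by omega)
    · rw [hprod, hpn]
      push_cast
      rfl
    · rw [List.length_drop] at hj
      rw [hprod, vertex_drop]
      -- After the last maximum the heights above `v` lie between `1` and `T`, hence between `1` and
      -- `T` below the top.
      have h1 := hl2 (n + j) (by omega) (by omega)
      have h2 := hmax (n + j) (by omega) (by omega)
      simp only [Pi.neg_apply]
      omega
  calc _ ≤ totalWeight f (halfSpaceLE h v T ∪ C) := totalWeight_mono_set f hsub
    _ ≤ _ := totalWeight_union_le f _ _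
    _ ≤ N + D * N := add_le_add hN hC
    _ = (1 + D) * N := by ring

/-- Each splitting swaps `h` and `-h`, so both bounds are proved together. The successive bridges
have strictly decreasing spans, whence one factor `1 + D s` per span. -/
lemma totalWeight_halfSpaceLE_le (f : Γ → ℝ≥0∞) (D : ℕ → ℝ≥0∞)
    (hD : ∀ v T, totalWeight f (bridgesOfSpan h v T) ≤ D T)
    (hD' : ∀ v T, totalWeight f (bridgesOfSpan (-h) v T) ≤ D T) (T : ℕ) :
    (∀ v, totalWeight f (halfSpaceLE h v T) ≤ ∏ s ∈ Finset.range T, (1 + D (s + 1))) ∧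
      ∀ v, totalWeight f (halfSpaceLE (-h) v T) ≤ ∏ s ∈ Finset.range T, (1 + D (s + 1)) := by
  induction T with
  | zero => simpa using ⟨totalWeight_halfSpaceLE_zero f, totalWeight_halfSpaceLE_zero f⟩
  | succ T ih =>
    simp only [Finset.prod_range_succ, mul_comm _ (1 + D (T + 1))]
    exact ⟨fun v => totalWeight_halfSpaceLE_succ f _ _ T v (hD v _) (ih.1 v) ih.2,
      fun v => totalWeight_halfSpaceLE_succ f _ _ T v (hD' v _) (ih.2 v)
        (by rw [neg_neg]; exact ih.1)⟩

lemma prod_one_add_le_exp (D : ℕ → ℝ≥0∞) (hD : ∑' s, D s ≠ ∞) (T : ℕ) :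
    ∏ s ∈ Finset.range T, (1 + D (s + 1)) ≤ ENNReal.ofReal (Real.exp (∑' s, D s).toReal) := by
  have hfin : ∀ s, D s ≠ ∞ := ENNReal.ne_top_of_tsum_ne_top hD
  calc ∏ s ∈ Finset.range T, (1 + D (s + 1))
      ≤ ∏ s ∈ Finset.range T, ENNReal.ofReal (Real.exp (D (s + 1)).toReal) := by
        refine Finset.prod_le_prod' fun s _ => ?_
        rw [← ENNReal.ofReal_toReal (hfin (s + 1)), ← ENNReal.ofReal_one,
          ← ENNReal.ofReal_add zero_le_one ENNReal.toReal_nonneg,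
          ENNReal.toReal_ofReal ENNReal.toReal_nonneg, add_comm]
        exact ENNReal.ofReal_le_ofReal (Real.add_one_le_exp _)
    _ = ENNReal.ofReal (Real.exp (∑ s ∈ Finset.range T, D (s + 1)).toReal) := by
        rw [ENNReal.toReal_sum fun s _ => hfin _, Real.exp_sum,
          ENNReal.ofReal_prod_of_nonneg fun s _ => (Real.exp_pos _).le]
    _ ≤ _ := by
        refine ENNReal.ofReal_le_ofReal (Real.exp_le_exp.2 (ENNReal.toReal_mono hD ?_))
        calc ∑ s ∈ Finset.range T, D (s + 1) ≤ ∑' s, D (s + 1) := ENNReal.sum_le_tsum _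
          _ ≤ ∑' s, D s :=
            ENNReal.tsum_comp_le_tsum_of_injective (add_left_injective 1) D

/-- Finitely many walks reach only a bounded height; `e` is a crude bound for the height of one
walk. -/
lemma totalWeight_halfSpace_le (f : Γ → ℝ≥0∞) (v : Γ) (N : ℝ≥0∞)
    (hN : ∀ T, totalWeight f (halfSpaceLE h v T) ≤ N) : totalWeight f (halfSpace h v) ≤ N := by
  refine totalWeight_le_of_finset f _ _ fun s => ?_
  let e : List Γ → ℕ := fun l =>
    ∑ i ∈ Finset.range (l.length + 1), (h (vertex v l i) - h v).natAbs
  refine le_trans ?_ (hN (∑ l ∈ s, e l))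
  refine le_trans (Finset.sum_le_sum fun l hl => ?_) (ENNReal.sum_le_tsum s)
  by_cases hm : l ∈ halfSpace h v
  · rw [Set.indicator_of_mem hm, Set.indicator_of_mem]
    refine ⟨hm.1, fun i h0 hi => ⟨hm.2 i h0 hi, ?_⟩⟩
    have h1 : (h (vertex v l i) - h v).natAbs ≤ e l :=
      Finset.single_le_sum (f := fun i => (h (vertex v l i) - h v).natAbs)
        (fun _ _ => Nat.zero_le _) (Finset.mem_range.2 (by omega))
    have h2 : e l ≤ ∑ l ∈ s, e l := Finset.single_le_sum (fun _ _ => Nat.zero_le _) hl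
    omega
  · rw [Set.indicator_of_notMem hm]
    exact zero_le

lemma tsum_totalWeight_bridgesOfSpan_le (f : Γ → ℝ≥0∞) (v : Γ) :
    ∑' T, totalWeight f (bridgesOfSpan h v T) ≤ totalWeight f {l | IsBridge h v l} := by
  rw [← tsum_totalWeight_fiber f _ fun l => (h (v * l.prod) - h v).toNat]
  refine ENNReal.tsum_le_tsum fun T => totalWeight_mono_set f fun l hl => ⟨hl.1, ?_⟩
  rw [hl.2]
  omega

/-- If the bridges, upwards and downwards, have finite total weight then so do the half-space
walks, uniformly in the starting point. -/
lemma exists_totalWeight_halfSpace_le [Finite Q] (hq : IsTypedHeight h q)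
    (hsurj : Function.Surjective q) (f : Γ → ℝ≥0∞)
    (hb : ∀ v, totalWeight f {l | IsBridge h v l} ≠ ∞)
    (hb' : ∀ v, totalWeight f {l | IsBridge (-h) v l} ≠ ∞) :
    ∃ N, N ≠ ∞ ∧ ∀ v, totalWeight f (halfSpace h v) ≤ N := by
  cases nonempty_fintype Q
  choose r hr using hsurj
  let D : ℕ → ℝ≥0∞ := fun T => ∑ t, (totalWeight f (bridgesOfSpan h (r t) T) +
    totalWeight f (bridgesOfSpan (-h) (r t) T))
  have hle : ∀ h' : Γ → ℤ, IsTypedHeight h' q → ∀ v T,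
      totalWeight f (bridgesOfSpan h' v T) ≤ totalWeight f (bridgesOfSpan h' (r (q v)) T) := by
    refine fun h' hq' v T => totalWeight_mono_set f fun l hl =>
      ⟨hl.1.congr hq' (hr (q v)).symm, ?_⟩
    have h1 := hq' v _ (hr (q v)).symm l.prod
    have h2 := hl.2
    omega
  have hD : ∀ v T, totalWeight f (bridgesOfSpan h v T) ≤ D T := fun v T =>
    (hle h hq v T).trans (le_self_add.trans
      (Finset.single_le_sum (f := fun t => totalWeight f (bridgesOfSpan h (r t) T) +
        totalWeight f (bridgesOfSpan (-h) (r t) T)) (fun _ _ => zero_le) (Finset.mem_univ (q v))))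
  have hD' : ∀ v T, totalWeight f (bridgesOfSpan (-h) v T) ≤ D T := fun v T =>
    (hle (-h) hq.neg v T).trans (le_add_self.trans
      (Finset.single_le_sum (f := fun t => totalWeight f (bridgesOfSpan h (r t) T) +
        totalWeight f (bridgesOfSpan (-h) (r t) T)) (fun _ _ => zero_le) (Finset.mem_univ (q v))))
  have hsum : ∑' T, D T ≠ ∞ := by
    rw [Summable.tsum_finsetSum fun _ _ => ENNReal.summable]
    refine ENNReal.sum_ne_top.2 fun t _ => ?_
    rw [ENNReal.tsum_add]
    exact ENNReal.add_ne_top.2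
      ⟨ne_top_of_le_ne_top (hb _) (tsum_totalWeight_bridgesOfSpan_le f _),
        ne_top_of_le_ne_top (hb' _) (tsum_totalWeight_bridgesOfSpan_le f _)⟩
  exact ⟨_, ENNReal.ofReal_ne_top, fun v => totalWeight_halfSpace_le f v _ fun T =>
    ((totalWeight_halfSpaceLE_le f D hD hD' T).1 v).trans (prod_one_add_le_exp D hsum T)⟩

/-- A weak half-space walk becomes a half-space walk when preceded by an ascending step. -/
lemma mul_totalWeight_weakHalfSpace_le (f : Γ → ℝ≥0∞) (v g : Γ) (hg : h (v * g⁻¹) < h v) :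
    f g * totalWeight f (weakHalfSpace h v) ≤ totalWeight f (halfSpace h (v * g⁻¹)) := by
  have := mul_totalWeight_le f {[g]} (halfSpace h (v * g⁻¹)) (fun _ => weakHalfSpace h v)
    (totalWeight f (weakHalfSpace h v)) 1 (by simp) (fun _ _ => le_rfl) ?_
  · simpa using this
  rintro _ rfl b hb
  have hv : ∀ i ≤ b.length, h (v * g⁻¹) < h (vertex (v * g⁻¹) (g :: b) (i + 1)) := by
    intro i hi
    rw [vertex_cons_succ, inv_mul_cancel_right]
    exact hg.trans_le (hb.2 i hi)
  refine ⟨?_, fun i h0 hi => ?_⟩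
  · rw [selfAvoiding_iff (v * g⁻¹)]
    intro i j hij hj
    have hb1 := (selfAvoiding_iff v b).1 hb.1
    obtain ⟨j, rfl⟩ : ∃ k, j = k + 1 := ⟨j - 1, by omega⟩
    simp only [List.singleton_append, List.length_cons] at hj ⊢
    rcases i with _ | i
    · intro e
      have := hv j (by omega)
      rw [← e, vertex_zero] at this
      exact this.false
    · rw [vertex_cons_succ, vertex_cons_succ, inv_mul_cancel_right]
      exact hb1 i j (by omega) (by omega)
  · obtain ⟨i, rfl⟩ : ∃ k, i = k + 1 := ⟨i - 1, by omega⟩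
    simp only [List.singleton_append, List.length_cons] at hi ⊢
    exact hv i (by omega)

/-! ### Reversal -/

/-- The increments of the reversed walk. -/
def reversal (l : List Γ) : List Γ := (l.map fun g => g⁻¹).reverse

@[simp] lemma reversal_reversal (l : List Γ) : reversal (reversal l) = l := by
  simp [reversal, ← List.map_reverse]

@[simp] lemma length_reversal (l : List Γ) : (reversal l).length = l.length := by
  simp [reversal]

lemma listWeight_reversal (f : Γ → ℝ≥0∞) (hf : ∀ g, f g⁻¹ = f g) (l : List Γ) :
    listWeight f (reversal l) = listWeight f l := by
  simp [listWeight, reversal, List.prod_reverse, Function.comp_def, hf]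

lemma prod_reversal (l : List Γ) : (reversal l).prod = l.prod⁻¹ := (List.prod_inv_reverse l).symm

lemma vertex_reversal (v : Γ) (l : List Γ) (i : ℕ) :
    vertex (v * l.prod) (reversal l) i = vertex v l (l.length - i) := by
  have h1 : (reversal l).take i = reversal (l.drop (l.length - i)) := by
    simp [reversal, List.take_reverse, List.map_drop]
  have h2 : l.prod = (l.take (l.length - i)).prod * (l.drop (l.length - i)).prod := by
    rw [← List.prod_append, List.take_append_drop]
  rw [vertex, h1, prod_reversal, vertex, h2]
  group

lemma SelfAvoiding.reversal {l : List Γ} (hl : SelfAvoiding l) :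
    SelfAvoiding (IncrementList.reversal l) := by
  rw [selfAvoiding_iff 1] at hl
  rw [selfAvoiding_iff (1 * l.prod)]
  intro i j hij hj
  rw [length_reversal] at hj
  rw [vertex_reversal, vertex_reversal]
  exact (hl _ _ (by omega) (by omega)).symm

/-- If the half-space walks have uniformly bounded total weight, then the total weight of all
self-avoiding walks is finite. -/
lemma totalWeight_selfAvoiding_ne_top [Finite Q] (hq : IsTypedHeight h q)
    (hsurj : Function.Surjective q) (f : Γ → ℝ≥0∞) (hf : ∀ g, f g⁻¹ = f g)
    (hdown : ∀ v, ∃ g, f g ≠ 0 ∧ h (v * g⁻¹) < h v) (N : ℝ≥0∞) (hN0 : N ≠ ∞)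
    (hN : ∀ v, totalWeight f (halfSpace h v) ≤ N) :
    totalWeight f {l | SelfAvoiding l} ≠ ∞ := by
  classical
  cases nonempty_fintype Q
  choose r hr using hsurj
  have hweak : ∀ v, totalWeight f (weakHalfSpace h v) ≠ ∞ := by
    intro v htop
    obtain ⟨g, hg, hlt⟩ := hdown v
    have h1 := (mul_totalWeight_weakHalfSpace_le f v g hlt).trans (hN _)
    rw [htop, ENNReal.mul_top hg] at h1
    exact hN0 (top_le_iff.1 h1)
  -- The walks that end at a lowest point. Reversed and grouped by the type of their end, they
  -- inject into the weak half-space walks from one representative of each type.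
  let A : Set (List Γ) := {l | reversal l ∈ weakHalfSpace h l.prod}
  have hA : totalWeight f A ≠ ∞ := by
    have h1 : totalWeight f A ≤ ∑ t, totalWeight f (weakHalfSpace h (r t)) := by
      rw [← tsum_totalWeight_fiber f A fun l => q l.prod, tsum_fintype]
      refine Finset.sum_le_sum fun t _ => ?_
      rw [totalWeight_eq_tsum_subtype, totalWeight_eq_tsum_subtype]
      let e : {l | l ∈ A ∧ q l.prod = t} → weakHalfSpace h (r t) := fun l =>
        ⟨reversal l.1, l.2.1.1, fun i hi => by
          have h1 := l.2.1.2 i hi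
          have h2 := hq.vertex (l.2.2.trans (hr t).symm) (reversal l.1) i
          omega⟩
      have he : Function.Injective e := fun l l' hll => by
        have := congrArg Subtype.val hll
        apply Subtype.ext
        rw [← reversal_reversal l.1, ← reversal_reversal l'.1]
        exact congrArg reversal this
      refine le_trans (le_of_eq ?_)
        (ENNReal.tsum_comp_le_tsum_of_injective he fun l => listWeight f l.1)
      exact tsum_congr fun l => (listWeight_reversal f hf l.1).symm
    exact ne_top_of_le_ne_top (ENNReal.sum_ne_top.2 fun t _ => hweak _) h1
  refine ne_top_of_le_ne_top (ENNReal.mul_ne_top hA hN0)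
    (totalWeight_le_mul f _ A (fun a => halfSpace h a.prod) N ?_ fun a _ => hN _)
  intro l hl
  -- The walk is split at its last visit to its minimal height: what precedes lies in `A`, and what
  -- follows stays strictly above.
  obtain ⟨m, hm, hmin⟩ := Finset.exists_min_image (Finset.range (l.length + 1))
    (fun i => h (vertex 1 l i)) ⟨0, by simp⟩
  let p : ℕ → Prop := fun i => h (vertex 1 l i) = h (vertex 1 l m)
  let n := Nat.findGreatest p l.length
  have hn : n ≤ l.length := Nat.findGreatest_le _
  have hpn : h (vertex 1 l n) = h (vertex 1 l m) :=
    Nat.findGreatest_spec (P := p) (by simpa [Nat.lt_succ_iff] using hm) rfl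
  have hmax : ∀ j, n < j → j ≤ l.length → h (vertex 1 l j) ≠ h (vertex 1 l m) :=
    fun j h1 h2 => Nat.findGreatest_is_greatest (P := p) h1 h2
  have hmin' : ∀ j ≤ l.length, h (vertex 1 l m) ≤ h (vertex 1 l j) := fun j hj =>
    hmin j (Finset.mem_range.2 (by omega))
  have hlen : (l.take n).length = n := by simp [hn]
  have hprod : (l.take n).prod = vertex 1 l n := by simp [vertex]
  refine ⟨n, ⟨(hl.take n).reversal, fun i hi => ?_⟩, hl.drop n, fun i h0 hi => ?_⟩
  · rw [length_reversal, hlen] at hi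
    have h1 := vertex_reversal 1 (l.take n) i
    rw [one_mul, hlen, vertex_take _ _ (Nat.sub_le _ _)] at h1
    rw [h1, hprod, hpn]
    exact hmin' _ (by omega)
  · rw [List.length_drop] at hi
    rw [hprod, vertex_drop, hpn]
    exact lt_of_le_of_ne (hmin' _ (by omega)) (hmax _ (by omega) (by omega)).symm

end HammersleyWelsh

end IncrementList

/-! ### Weighted generating functions and truncation -/

namespace IncrementList

section Truncation

variable {Γ Q : Type*} [Group Γ] [Group Q] {h : Γ → ℤ} {q : Γ →* Q} {φ ℓ : Γ → ℝ}

/-- The weight `φ(γ) x^{ℓ(γ)}` of a step in the generating function at `x`. -/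
noncomputable def stepWeight (φ ℓ : Γ → ℝ) (x : ℝ) (g : Γ) : ℝ≥0∞ :=
  ENNReal.ofReal (φ g * x ^ ℓ g)

/-- The generating function of self-avoiding walks. -/
noncomputable def sawSeries (φ ℓ : Γ → ℝ) (x : ℝ) : ℝ≥0∞ :=
  totalWeight (stepWeight φ ℓ x) {l | SelfAvoiding l}

omit [Group Γ] in
lemma stepWeight_pos {x : ℝ} (hx : 0 < x) {g : Γ} (hg : 0 < φ g) : stepWeight φ ℓ x g ≠ 0 := by
  rw [stepWeight, ne_eq, ENNReal.ofReal_eq_zero, not_le]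
  exact mul_pos hg (Real.rpow_pos_of_pos hx _)

omit [Group Γ] in
lemma listWeight_ne_zero {f : Γ → ℝ≥0∞} {l : List Γ} (hl : ∀ g ∈ l, f g ≠ 0) :
    listWeight f l ≠ 0 := by
  rw [listWeight, ne_eq, List.prod_eq_zero_iff, List.mem_map]
  rintro ⟨g, hg, h0⟩
  exact hl g hg h0

omit [Group Γ] in
lemma eventually_truncate_eq (h0 : ∀ g, 0 ≤ φ g) (g : Γ) :
    ∀ᶠ η in 𝓝[>] (0 : ℝ), truncate φ η g = φ g := by
  rcases (h0 g).eq_or_lt with hg | hg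
  · exact Eventually.of_forall fun η => by simp [truncate, ← hg]
  · filter_upwards [Ioo_mem_nhdsGT hg] with η hη
    simp [truncate, hη.2.le]

omit [Group Γ] in
lemma eventually_listWeight_truncate_eq (h0 : ∀ g, 0 ≤ φ g) (x : ℝ) (l : List Γ) :
    ∀ᶠ η in 𝓝[>] (0 : ℝ), listWeight (stepWeight (truncate φ η) ℓ x) l =
      listWeight (stepWeight φ ℓ x) l := by
  induction l with
  | nil => simp
  | cons g l ih =>
    filter_upwards [ih, eventually_truncate_eq h0 g] with η h1 h2
    simp [h1, h2, stepWeight]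

/-- A uniform bound for the bridges with a given number of steps passes to the limit `η ↓ 0`. -/
lemma totalWeight_bridgesTo_le_of_truncate (hq : IsTypedHeight h q) (h0 : ∀ g, 0 ≤ φ g) {x : ℝ}
    (hfin : ∀ᶠ η in 𝓝[>] (0 : ℝ), sawSeries (truncate φ η) ℓ x ≠ ∞) (v w : Γ) (n : ℕ)
    (b : List Γ) (hb : IsBridge h w b) (hbv : q (w * b.prod) = q v) :
    totalWeight (stepWeight φ ℓ x) (bridgesTo h q v w n) ≤
      (listWeight (stepWeight φ ℓ x) b)⁻¹ := by
  refine totalWeight_le_of_finset _ _ _ fun s => ?_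
  -- Finitely many lists involve finitely many increments, so one small `η` changes neither them nor
  -- `b`, and the bound for the truncated weights applies.
  have h1 : ∀ᶠ η in 𝓝[>] (0 : ℝ), ∀ l ∈ s, listWeight (stepWeight (truncate φ η) ℓ x) l =
      listWeight (stepWeight φ ℓ x) l :=
    (Finset.eventually_all s).2 fun l _ => eventually_listWeight_truncate_eq h0 x l
  obtain ⟨η, h1, h2, h3⟩ :=
    (h1.and ((eventually_listWeight_truncate_eq (ℓ := ℓ) h0 x b).and hfin)).exists
  rw [← h2]
  refine le_trans ?_ (totalWeight_bridgesTo_le hq _ h3 v w n b hb hbv)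
  refine le_trans (Finset.sum_le_sum fun l hl => ?_) (ENNReal.sum_le_tsum s)
  by_cases hm : l ∈ bridgesTo h q v w n
  · rw [Set.indicator_of_mem hm, Set.indicator_of_mem hm, h1 l hl]
  · rw [Set.indicator_of_notMem hm]
    exact zero_le

-- Every step has length at least `c`, so moving from `x` down to `y` gains a fixed factor per step.
-- This turns bounds uniform in the number of steps into geometric decay.
omit [Group Γ] in
lemma stepWeight_le_mul (h0 : ∀ g, 0 ≤ φ g) {c x y : ℝ} (hℓ : ∀ g, c ≤ ℓ g) (hy : 0 < y)
    (hyx : y < x) (g : Γ) :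
    stepWeight φ ℓ y g ≤ ENNReal.ofReal ((y / x) ^ c) * stepWeight φ ℓ x g := by
  have hx : 0 < x := hy.trans hyx
  have hr : 0 < y / x := div_pos hy hx
  rw [stepWeight, stepWeight, ← ENNReal.ofReal_mul (Real.rpow_nonneg hr.le _)]
  refine ENNReal.ofReal_le_ofReal ?_
  have h1 : y ^ ℓ g = (y / x) ^ ℓ g * x ^ ℓ g := by
    rw [← Real.mul_rpow hr.le hx.le, div_mul_cancel₀ _ hx.ne']
  have h2 : (y / x) ^ ℓ g ≤ (y / x) ^ c :=
    Real.rpow_le_rpow_of_exponent_ge hr ((div_le_one hx).2 hyx.le) (hℓ g)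
  have h3 : 0 ≤ φ g * x ^ ℓ g := mul_nonneg (h0 g) (Real.rpow_nonneg hx.le _)
  calc φ g * y ^ ℓ g = (y / x) ^ ℓ g * (φ g * x ^ ℓ g) := by rw [h1]; ring
    _ ≤ (y / x) ^ c * (φ g * x ^ ℓ g) := mul_le_mul_of_nonneg_right h2 h3

omit [Group Γ] in
lemma listWeight_le_pow_mul {f g : Γ → ℝ≥0∞} {r : ℝ≥0∞} (hfg : ∀ x, f x ≤ r * g x)
    (l : List Γ) : listWeight f l ≤ r ^ l.length * listWeight g l := by
  induction l with
  | nil => simp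
  | cons x l ih =>
    rw [listWeight_cons, listWeight_cons, List.length_cons, pow_succ']
    calc _ ≤ (r * g x) * (r ^ l.length * listWeight g l) := mul_le_mul' (hfg x) ih
      _ = _ := by ring

lemma totalWeight_isBridge_ne_top [Finite Q]
    (hsurj : Function.Surjective q) (f g : Γ → ℝ≥0∞) (r : ℝ≥0∞) (hr : r < 1)
    (hfg : ∀ x, f x ≤ r * g x)
    (hbd : ∀ v w, ∃ K, K ≠ ∞ ∧ ∀ n, totalWeight g (bridgesTo h q v w n) ≤ K) (v : Γ) :
    totalWeight f {l | IsBridge h v l} ≠ ∞ := by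
  cases nonempty_fintype Q
  choose s hs using hsurj
  choose K hK hKb using hbd
  have hn : ∀ n, totalWeight f {l | l ∈ {l | IsBridge h v l} ∧ l.length = n} ≤
      r ^ n * ∑ t, K v (s t) := by
    intro n
    calc _ ≤ r ^ n * totalWeight g {l | l ∈ {l | IsBridge h v l} ∧ l.length = n} := by
          rw [totalWeight, totalWeight, ← ENNReal.tsum_mul_left]
          refine ENNReal.tsum_le_tsum fun l => ?_
          by_cases hm : l ∈ {l | l ∈ {l | IsBridge h v l} ∧ l.length = n}
          · rw [Set.indicator_of_mem hm, Set.indicator_of_mem hm, ← hm.2]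
            exact listWeight_le_pow_mul hfg l
          · rw [Set.indicator_of_notMem hm]
            exact zero_le
      _ ≤ _ := by
          refine mul_le_mul_right ?_ _
          rw [← tsum_totalWeight_fiber g _ fun l => q (v * l.prod), tsum_fintype]
          refine Finset.sum_le_sum fun t _ => ?_
          refine (totalWeight_mono_set g ?_).trans (hKb v (s t) n)
          exact fun l hl => ⟨hl.1.1, hl.1.2, by rw [hs]; exact hl.2⟩
  rw [← tsum_totalWeight_fiber f _ List.length]
  refine ne_top_of_le_ne_top ?_ (ENNReal.tsum_le_tsum hn)
  rw [ENNReal.tsum_mul_right, ENNReal.tsum_geometric]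
  refine ENNReal.mul_ne_top ?_ (ENNReal.sum_ne_top.2 fun t _ => hK _ _)
  rw [ENNReal.inv_ne_top]
  exact (tsub_pos_of_lt hr).ne'

/-- If the generating functions of the truncated weights are all finite at `x`, then the generating
function of `φ` is finite at every smaller point. -/
theorem sawSeries_ne_top_of_truncate [Finite Q] (hq : IsTypedHeight h q)
    (hsurj : Function.Surjective q) (h0 : ∀ g, 0 ≤ φ g) (hφ : ∀ g, φ g⁻¹ = φ g)
    (hℓs : ∀ g, ℓ g⁻¹ = ℓ g) {c : ℝ} (hc : 0 < c) (hℓ : ∀ g, c ≤ ℓ g)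
    (hconn : ∀ u v : Γ, ∃ l : List Γ, (∀ g ∈ l, 0 < φ g) ∧ u * l.prod = v)
    (hup : ∀ v, ∃ g, 0 < φ g ∧ h v < h (v * g)) (hdown : ∀ v, ∃ g, 0 < φ g ∧ h (v * g) < h v)
    {x y : ℝ} (hy : 0 < y) (hyx : y < x)
    (hfin : ∀ᶠ η in 𝓝[>] (0 : ℝ), sawSeries (truncate φ η) ℓ x ≠ ∞) :
    sawSeries φ ℓ y ≠ ∞ := by
  have hx : 0 < x := hy.trans hyx
  have hflip : ∀ {p : Γ → Prop} (v : Γ), (∃ g, 0 < φ g ∧ p (v * g)) →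
      ∃ g, 0 < φ g ∧ p (v * g⁻¹) := by
    rintro p v ⟨g, hg, hp⟩
    exact ⟨g⁻¹, by rwa [hφ], by rwa [inv_inv]⟩
  have hbridge : ∀ h' : Γ → ℤ, IsTypedHeight h' q → (∀ v, ∃ g, 0 < φ g ∧ h' v < h' (v * g)) →
      (∀ v, ∃ g, 0 < φ g ∧ h' (v * g) < h' v) →
      ∀ v, totalWeight (stepWeight φ ℓ y) {l | IsBridge h' v l} ≠ ∞ := by
    intro h' hq' hup' hdown'
    refine totalWeight_isBridge_ne_top hsurj _ (stepWeight φ ℓ x) _ ?_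
      (stepWeight_le_mul h0 hℓ hy hyx) fun v w => ?_
    · rw [ENNReal.ofReal_lt_one]
      exact Real.rpow_lt_one (div_pos hy hx).le ((div_lt_one hx).2 hyx) hc
    -- The returning bridge uses only steps of positive weight, so the inverse of its weight is a
    -- finite bound.
    · obtain ⟨b, hbP, hb, hbv⟩ := exists_isBridge hq' hsurj (fun g => 0 < φ g) hconn hup'
        (fun v => hflip (p := fun u => h' u < h' v) v (hdown' v)) w v
      exact ⟨_, ENNReal.inv_ne_top.2 (listWeight_ne_zero fun g hg => stepWeight_pos hx (hbP g hg)),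
        fun n => totalWeight_bridgesTo_le_of_truncate hq' h0 hfin v w n b hb hbv⟩
  have h1 := hbridge h hq hup hdown
  have h2 := hbridge (-h) hq.neg (fun v => by simpa using hdown v) (fun v => by simpa using hup v)
  obtain ⟨N, hN0, hN⟩ := exists_totalWeight_halfSpace_le hq hsurj _ h1 h2
  refine totalWeight_selfAvoiding_ne_top hq hsurj _ (fun g => by simp [stepWeight, hφ, hℓs])
    (fun v => ?_) N hN0 hN
  obtain ⟨g, hg, hlt⟩ := hflip (p := fun u => h u < h v) v (hdown v)
  exact ⟨g, stepWeight_pos hy hg, hlt⟩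

end Truncation

end IncrementList

/-! ### Self-avoiding walks as lists of increments -/

namespace SAW

open IncrementList

variable {Γ : Type*} [Group Γ] {v : Γ}

/-- The list of increments of a walk. -/
def increments (π : SAW Γ v) : List Γ := List.ofFn π.incr

@[simp] lemma length_increments (π : SAW Γ v) : π.increments.length = π.steps := by
  simp [increments]

lemma vertex_increments (π : SAW Γ v) (i : ℕ) (hi : i < π.steps + 1) :
    vertex v π.increments i = π.vert ⟨i, hi⟩ := by
  induction i with
  | zero => rw [vertex_zero]; exact π.start.symm
  | succ i ih =>
    have h1 : π.increments[i]? = some (π.incr ⟨i, by omega⟩) := by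
      rw [increments, List.getElem?_ofFn, dif_pos]
    have h2 : vertex v π.increments (i + 1) =
        vertex v π.increments i * π.incr ⟨i, by omega⟩ := by
      rw [vertex, vertex, List.take_add_one, h1]
      simp [mul_assoc]
    rw [h2, ih (by omega), incr]
    simp

lemma selfAvoiding_increments (π : SAW Γ v) : SelfAvoiding π.increments := by
  rw [selfAvoiding_iff v]
  intro i j hij hj e
  rw [length_increments] at hj
  rw [vertex_increments π i (by omega), vertex_increments π j (by omega)] at e
  have := congrArg Fin.val (π.injective e)
  simp only at this
  omega

lemma prod_increments (π : SAW Γ v) : v * π.increments.prod = π.last := by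
  rw [← vertex_length, length_increments, vertex_increments π _ (by omega)]
  rfl

/-- The walk with given increments. -/
def ofIncrements (v : Γ) (l : List Γ) (hl : SelfAvoiding l) : SAW Γ v where
  steps := l.length
  vert i := vertex v l i
  start := vertex_zero v l
  injective := by
    intro i j e
    rw [selfAvoiding_iff v] at hl
    rcases lt_trichotomy i j with hij | hij | hij
    · exact absurd e (hl i j hij (by omega))
    · exact hij
    · exact absurd e.symm (hl j i hij (by omega))

lemma increments_ofIncrements (v : Γ) (l : List Γ) (hl : SelfAvoiding l) :
    (ofIncrements v l hl).increments = l := by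
  refine List.ext_getElem (by simp [ofIncrements]) fun i h1 h2 => ?_
  simp only [increments, List.getElem_ofFn, incr]
  change (vertex v l i)⁻¹ * vertex v l (i + 1) = l[i]
  have h3 : vertex v l (i + 1) = vertex v l i * l[i] := by
    rw [vertex, vertex, List.take_add_one, List.getElem?_eq_getElem h2, Option.toList_some,
      List.prod_append, List.prod_singleton, mul_assoc]
  rw [h3, inv_mul_cancel_left]

lemma increments_injective : Function.Injective (increments (v := v)) := by
  intro π π' e
  have hs : π.steps = π'.steps := by rw [← length_increments, e, length_increments]
  have hv : ∀ i (hi : i < π.steps + 1) (hi' : i < π'.steps + 1),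
      π.vert ⟨i, hi⟩ = π'.vert ⟨i, hi'⟩ := fun i hi hi' => by
    rw [← vertex_increments, ← vertex_increments, e]
  obtain ⟨n, p, _, _⟩ := π
  obtain ⟨n', p', _, _⟩ := π'
  obtain rfl : n = n' := hs
  obtain rfl : p = p' := funext fun i => hv i i.2 i.2
  rfl

/-- Walks from `v` correspond to self-avoiding lists of increments. -/
noncomputable def equivIncrements (v : Γ) : SAW Γ v ≃ {l : List Γ // SelfAvoiding l} :=
  Equiv.ofBijective (fun π => ⟨π.increments, π.selfAvoiding_increments⟩)
    ⟨fun _ _ e => increments_injective (congrArg Subtype.val e),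
      fun l => ⟨ofIncrements v l.1 l.2, Subtype.ext (increments_ofIncrements v l.1 l.2)⟩⟩

lemma weight_eq (φ : Γ → ℝ) (π : SAW Γ v) : π.weight φ = (π.increments.map φ).prod := by
  simp [weight, increments, List.prod_ofFn, List.map_ofFn]

lemma length_eq (ℓ : Γ → ℝ) (π : SAW Γ v) : π.length ℓ = (π.increments.map ℓ).sum := by
  simp [length, increments, List.sum_ofFn, List.map_ofFn]

lemma listWeight_stepWeight {φ ℓ : Γ → ℝ} (h0 : ∀ g, 0 ≤ φ g) {x : ℝ} (hx : 0 < x)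
    (π : SAW Γ v) : listWeight (stepWeight φ ℓ x) π.increments =
      ENNReal.ofReal (π.weight φ) * ENNReal.ofReal (x ^ π.length ℓ) := by
  rw [weight_eq, length_eq]
  induction π.increments with
  | nil => simp
  | cons g l ih =>
    have h1 : 0 ≤ (l.map φ).prod := List.prod_nonneg (by simp; exact fun g _ => h0 g)
    rw [listWeight_cons, ih, stepWeight, List.map_cons, List.map_cons, List.prod_cons,
      List.sum_cons, Real.rpow_add hx, ENNReal.ofReal_mul (h0 g), ENNReal.ofReal_mul (h0 g),
      ENNReal.ofReal_mul (Real.rpow_nonneg hx.le _)]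
    ring

lemma sawSeries_eq {φ ℓ : Γ → ℝ} (h0 : ∀ g, 0 ≤ φ g) {x : ℝ} (hx : 0 < x) :
    sawSeries φ ℓ x = ∑' π : SAW Γ (1 : Γ),
      ENNReal.ofReal (π.weight φ) * ENNReal.ofReal (x ^ π.length ℓ) := by
  rw [sawSeries, totalWeight_eq_tsum_subtype]
  refine ((equivIncrements (1 : Γ)).tsum_eq fun l => listWeight (stepWeight φ ℓ x) l.1).symm.trans
    (tsum_congr fun π => ?_)
  exact listWeight_stepWeight h0 hx π

end SAW

/-! ### Spanning and truncated weight functions. -/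

lemma Spans.exists_list {Γ : Type*} [Group Γ] {φ : Γ → ℝ} (h0 : ∀ g, 0 ≤ φ g) (hs : Spans φ)
    (u v : Γ) : ∃ l : List Γ, (∀ g ∈ l, 0 < φ g) ∧ u * l.prod = v := by
  obtain ⟨π, hπ, hw⟩ := hs u v
  refine ⟨π.increments, fun g hg => ?_, π.prod_increments.trans hπ⟩
  refine (h0 g).lt_of_ne fun e => hw.ne' ?_
  rw [SAW.weight_eq, List.prod_eq_zero_iff, List.mem_map]
  exact ⟨g, hg, e.symm⟩

lemma spans_of_exists_list {Γ : Type*} [Group Γ] {φ : Γ → ℝ}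
    (hs : ∀ v : Γ, ∃ l : List Γ, (∀ g ∈ l, 0 < φ g) ∧ l.prod = v) : Spans φ := by
  intro u v
  obtain ⟨l, hl, hlv⟩ := hs (u⁻¹ * v)
  obtain ⟨l', h1, h2, h3, -⟩ := IncrementList.exists_selfAvoiding (fun g => 0 < φ g) u l hl
  refine ⟨SAW.ofIncrements u l' h1, ?_, ?_⟩
  · rw [← SAW.prod_increments, SAW.increments_ofIncrements, h3, hlv, mul_inv_cancel_left]
  · rw [SAW.weight_eq, SAW.increments_ofIncrements]
    exact List.prod_pos (by simpa using h2)

lemma truncate_antitone {Γ : Type*} {φ : Γ → ℝ} (h0 : ∀ g, 0 ≤ φ g) {a b : ℝ} (hab : a ≤ b)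
    (g : Γ) : truncate φ b g ≤ truncate φ a g := by
  unfold truncate
  split_ifs with h1 h2 h2
  · exact le_rfl
  · exact absurd (hab.trans h1) h2
  · exact h0 g
  · exact le_rfl

lemma truncate_le {Γ : Type*} {φ : Γ → ℝ} (h0 : ∀ g, 0 ≤ φ g) (η : ℝ) (g : Γ) :
    truncate φ η g ≤ φ g := by
  unfold truncate
  split_ifs
  exacts [le_rfl, h0 g]

lemma truncate_nonneg {Γ : Type*} {φ : Γ → ℝ} (h0 : ∀ g, 0 ≤ φ g) (η : ℝ) (g : Γ) :
    0 ≤ truncate φ η g := by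
  unfold truncate
  split_ifs
  exacts [h0 g, le_rfl]

/-- The truncation of a weight function at a small level is a weight function. -/
lemma IsWeightFunction.exists_truncate {Γ : Type*} [Group Γ] [Group.FG Γ] {φ : Γ → ℝ}
    (hφ : IsWeightFunction φ) :
    ∃ M, 0 < M ∧ ∀ η, 0 < η → η < M → IsWeightFunction (truncate φ η) := by
  classical
  obtain ⟨S, hS⟩ := Group.FG.out (G := Γ)
  choose L hLP hL using fun g : Γ => hφ.spans.exists_list hφ.nonneg 1 g
  -- Words in the support of `φ` for the finitely many generators involve finitely many elements,
  -- all of which survive truncation at a small level.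
  have hev : ∀ᶠ η in 𝓝[>] (0 : ℝ), ∀ s ∈ S, ∀ g ∈ (L s).toFinset, truncate φ η g = φ g :=
    (Finset.eventually_all S).2 fun s _ => (Finset.eventually_all _).2 fun g _ =>
      IncrementList.eventually_truncate_eq hφ.nonneg g
  obtain ⟨M, hM, hMs⟩ := mem_nhdsGT_iff_exists_Ioo_subset.1 hev
  refine ⟨M, hM, fun η h0 hηM => ?_⟩
  have hT : ∀ s ∈ S, ∀ g ∈ L s, 0 < truncate φ η g := fun s hs g hg => by
    rw [hMs ⟨h0, hηM⟩ s hs g (List.mem_toFinset.2 hg)]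
    exact hLP s g hg
  have hsymm : ∀ g, truncate φ η g⁻¹ = truncate φ η g := fun g => by simp [truncate, hφ.symm]
  refine ⟨truncate_nonneg hφ.nonneg η, by simp [truncate, hφ.map_one], hsymm,
    Summable.of_nonneg_of_le (truncate_nonneg hφ.nonneg η) (truncate_le hφ.nonneg η) hφ.summable,
    spans_of_exists_list fun v => ?_⟩
  have hv : v ∈ Subgroup.closure (S : Set Γ) := hS ▸ Subgroup.mem_top v
  induction hv using Subgroup.closure_induction with
  | mem s hs => exact ⟨L s, hT s hs, by simpa using hL s⟩
  | one => exact ⟨[], by simp⟩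
  | mul a b _ _ ha hb =>
    obtain ⟨la, h1, rfl⟩ := ha
    obtain ⟨lb, h2, rfl⟩ := hb
    refine ⟨la ++ lb, fun g hg => ?_, by simp⟩
    rcases List.mem_append.1 hg with hg | hg
    exacts [h1 g hg, h2 g hg]
  | inv a _ ha =>
    obtain ⟨la, h1, rfl⟩ := ha
    refine ⟨IncrementList.reversal la, fun g hg => ?_, IncrementList.prod_reversal la⟩
    simp only [IncrementList.reversal, List.mem_reverse, List.mem_map] at hg
    obtain ⟨g, hg, rfl⟩ := hg
    rw [hsymm]
    exact h1 g hg

/-! ### The connective constant as a radius of convergence -/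

namespace IncrementList

section Growth

variable {Γ : Type*} [Group Γ] {φ ℓ : Γ → ℝ}

/-- The exponential growth rate of the weights of self-avoiding walks with length in
`[m, m + c)`. -/
noncomputable def growthRate (φ ℓ : Γ → ℝ) (c : ℝ) : ℝ≥0∞ :=
  limsup (fun m : ℕ => sawWeight φ ℓ m c ^ (1 / (m : ℝ))) atTop

lemma sawWeight_mono {ψ : Γ → ℝ} (h0 : ∀ g, 0 ≤ φ g) (hle : ∀ g, φ g ≤ ψ g) {c d : ℝ}
    (hcd : c ≤ d) (m : ℝ) : sawWeight φ ℓ m c ≤ sawWeight ψ ℓ m d := by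
  calc sawWeight φ ℓ m c ≤ sawWeight ψ ℓ m c :=
        ENNReal.tsum_le_tsum fun π => ENNReal.ofReal_le_ofReal
          (Finset.prod_le_prod (fun _ _ => h0 _) fun _ _ => hle _)
    _ ≤ sawWeight ψ ℓ m d :=
        ENNReal.tsum_mono_subtype (fun π : SAW Γ (1 : Γ) => ENNReal.ofReal (π.weight ψ))
          fun π hπ => ⟨hπ.1, hπ.2.trans_le (by linarith)⟩

lemma growthRate_mono {ψ : Γ → ℝ} (h0 : ∀ g, 0 ≤ φ g) (hle : ∀ g, φ g ≤ ψ g) {c d : ℝ}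
    (hcd : c ≤ d) : growthRate φ ℓ c ≤ growthRate ψ ℓ d :=
  limsup_le_limsup (Eventually.of_forall fun m =>
    ENNReal.rpow_le_rpow (sawWeight_mono h0 hle hcd m) (by positivity))

/-- On a window of width `c` the power of `x` varies boundedly; `min 1 (x ^ c)` covers both `x ≥ 1`
and `x ≤ 1`. -/
lemma sawWeight_mul_le (h0 : ∀ g, 0 ≤ φ g) {x : ℝ} (hx : 0 < x) (m c : ℝ) :
    sawWeight φ ℓ m c * ENNReal.ofReal (x ^ m * min 1 (x ^ c)) ≤ sawSeries φ ℓ x := by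
  rw [SAW.sawSeries_eq h0 hx, sawWeight, ← ENNReal.tsum_mul_right]
  refine le_trans (ENNReal.tsum_le_tsum fun π => mul_le_mul_right (ENNReal.ofReal_le_ofReal ?_) _)
    (ENNReal.tsum_comp_le_tsum_of_injective Subtype.val_injective
      fun π : SAW Γ (1 : Γ) => ENNReal.ofReal (π.weight φ) * ENNReal.ofReal (x ^ π.length ℓ))
  obtain ⟨h1, h2⟩ := π.2
  have h3 : x ^ π.1.length ℓ = x ^ m * x ^ (π.1.length ℓ - m) := by
    rw [← Real.rpow_add hx]; congr 1; ring
  rw [h3]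
  refine mul_le_mul_of_nonneg_left ?_ (Real.rpow_nonneg hx.le _)
  rcases le_total 1 x with h | h
  · exact (min_le_left _ _).trans (Real.one_le_rpow h (by linarith))
  · exact (min_le_right _ _).trans (Real.rpow_le_rpow_of_exponent_ge hx h (by linarith))

lemma sawWeight_ne_top (h0 : ∀ g, 0 ≤ φ g) {x : ℝ} (hx : 0 < x) (hfin : sawSeries φ ℓ x ≠ ∞)
    (m c : ℝ) : sawWeight φ ℓ m c ≠ ∞ := by
  intro htop
  have h1 := sawWeight_mul_le (ℓ := ℓ) h0 hx m c
  have h2 : 0 < x ^ m * min 1 (x ^ c) :=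
    mul_pos (Real.rpow_pos_of_pos hx _) (lt_min one_pos (Real.rpow_pos_of_pos hx _))
  rw [htop, ENNReal.top_mul (ENNReal.ofReal_pos.2 h2).ne'] at h1
  exact hfin (top_le_iff.1 h1)

lemma growthRate_le (h0 : ∀ g, 0 ≤ φ g) {x : ℝ} (hx : 0 < x) (hfin : sawSeries φ ℓ x ≠ ∞)
    (c : ℝ) : growthRate φ ℓ c ≤ ENNReal.ofReal (1 / x) := by
  have hκ : 0 < min 1 (x ^ c) := lt_min one_pos (Real.rpow_pos_of_pos hx _)
  set κ := min 1 (x ^ c)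
  -- The `+ 1` makes `a` positive, so that its `m`-th root tends to `1`.
  set a : ℝ := (sawSeries φ ℓ x).toReal / κ + 1
  have ha : 0 < a := by positivity
  have hW : ∀ m : ℕ, sawWeight φ ℓ m c ≤ ENNReal.ofReal (a * (1 / x) ^ m) := by
    intro m
    have h1 := sawWeight_mul_le (ℓ := ℓ) h0 hx m c
    have h2 : 0 < x ^ (m : ℝ) * κ := mul_pos (Real.rpow_pos_of_pos hx _) hκ
    rw [← ENNReal.ofReal_toReal hfin, ← ENNReal.le_div_iff_mul_le
      (Or.inl (ENNReal.ofReal_pos.2 h2).ne') (Or.inl ENNReal.ofReal_ne_top),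
      ← ENNReal.ofReal_div_of_pos h2] at h1
    refine h1.trans (ENNReal.ofReal_le_ofReal ?_)
    rw [Real.rpow_natCast, one_div, inv_pow, mul_comm, ← div_div, div_eq_mul_inv]
    exact mul_le_mul_of_nonneg_right (by simp [a]) (by positivity)
  have hlim : Tendsto (fun m : ℕ => ENNReal.ofReal (a ^ (1 / (m : ℝ)) * (1 / x))) atTop
      (𝓝 (ENNReal.ofReal (1 / x))) := by
    refine ENNReal.tendsto_ofReal ?_
    have h1 : Tendsto (fun m : ℕ => a ^ (1 / (m : ℝ))) atTop (𝓝 (a ^ (0 : ℝ))) :=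
      tendsto_const_nhds.rpow tendsto_one_div_atTop_nhds_zero_nat (Or.inl ha.ne')
    simpa using h1.mul_const (1 / x)
  rw [← hlim.limsup_eq]
  refine limsup_le_limsup ?_
  filter_upwards [eventually_gt_atTop 0] with m hm
  have hm' : (m : ℝ) ≠ 0 := by positivity
  calc sawWeight φ ℓ m c ^ (1 / (m : ℝ))
      ≤ ENNReal.ofReal (a * (1 / x) ^ m) ^ (1 / (m : ℝ)) :=
        ENNReal.rpow_le_rpow (hW m) (by positivity)
    _ = ENNReal.ofReal (a ^ (1 / (m : ℝ)) * (1 / x)) := by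
        rw [ENNReal.ofReal_rpow_of_pos (by positivity), Real.mul_rpow ha.le (by positivity),
          ← Real.rpow_natCast, ← Real.rpow_mul (by positivity), mul_one_div_cancel hm',
          Real.rpow_one]

/-- The root test: windows of width `1` tile the half-line of lengths, and `K` bounds the
contribution of the fractional part of the length. -/
lemma sawSeries_ne_top_of_growthRate_lt (h0 : ∀ g, 0 ≤ φ g) (hℓ : ∀ g, 0 ≤ ℓ g) {x : ℝ}
    (hx : 0 < x) (hW : ∀ m : ℕ, sawWeight φ ℓ m 1 ≠ ∞)
    (hlt : growthRate φ ℓ 1 < ENNReal.ofReal (1 / x)) : sawSeries φ ℓ x ≠ ∞ := by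
  set K : ℝ≥0∞ := ENNReal.ofReal (max 1 x)
  set X : ℝ≥0∞ := ENNReal.ofReal x
  have hle : sawSeries φ ℓ x ≤ ∑' m : ℕ, sawWeight φ ℓ m 1 * (X ^ m * K) := by
    let I : ℕ → Set (SAW Γ (1 : Γ)) := fun m => {π | m ≤ π.length ℓ ∧ π.length ℓ < m + 1}
    calc sawSeries φ ℓ x = ∑' π : SAW Γ (1 : Γ),
          ENNReal.ofReal (π.weight φ) * ENNReal.ofReal (x ^ π.length ℓ) := SAW.sawSeries_eq h0 hx
      _ ≤ ∑' π : SAW Γ (1 : Γ), ∑' m : ℕ,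
          (I m).indicator (fun π => ENNReal.ofReal (π.weight φ)) π * (X ^ m * K) := by
          refine ENNReal.tsum_le_tsum fun π => ?_
          have hL : 0 ≤ π.length ℓ := Finset.sum_nonneg fun _ _ => hℓ _
          refine le_trans ?_ (ENNReal.le_tsum ⌊π.length ℓ⌋₊)
          have h1 := Nat.floor_le hL
          have h2 := Nat.lt_floor_add_one (π.length ℓ)
          rw [Set.indicator_of_mem (show π ∈ I ⌊π.length ℓ⌋₊ from ⟨h1, h2⟩)]
          refine mul_le_mul_right ?_ _
          rw [← ENNReal.ofReal_pow hx.le, ← ENNReal.ofReal_mul (by positivity)]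
          refine ENNReal.ofReal_le_ofReal ?_
          have h3 : x ^ π.length ℓ = x ^ ⌊π.length ℓ⌋₊ * x ^ (π.length ℓ - ⌊π.length ℓ⌋₊) := by
            rw [← Real.rpow_natCast, ← Real.rpow_add hx]; congr 1; ring
          rw [h3]
          refine mul_le_mul_of_nonneg_left ?_ (by positivity)
          rcases le_total 1 x with h | h
          · refine le_trans ?_ (le_max_right _ _)
            exact (Real.rpow_le_rpow_of_exponent_le h (by linarith)).trans_eq (Real.rpow_one x)
          · exact (Real.rpow_le_one hx.le h (by linarith)).trans (le_max_left _ _)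
      _ = ∑' m : ℕ, sawWeight φ ℓ m 1 * (X ^ m * K) := by
          rw [ENNReal.tsum_comm]
          refine tsum_congr fun m => ?_
          rw [ENNReal.tsum_mul_right, ← tsum_subtype]
          rfl
  refine ne_top_of_le_ne_top ?_ hle
  obtain ⟨b, hb1, hb2⟩ := exists_between hlt
  obtain ⟨N, hN⟩ := eventually_atTop.1 (eventually_lt_of_limsup_lt hb1)
  have hbX : b * X < 1 := by
    calc b * X < ENNReal.ofReal (1 / x) * X :=
          (ENNReal.mul_lt_mul_iff_left (ENNReal.ofReal_pos.2 hx).ne' ENNReal.ofReal_ne_top).2 hb2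
      _ = 1 := by
          rw [← ENNReal.ofReal_mul (by positivity), one_div_mul_cancel hx.ne', ENNReal.ofReal_one]
  have hterm : ∀ m : ℕ, sawWeight φ ℓ m 1 * (X ^ m * K) ≤
      -- Using `N + 1` instead of `N` puts `m = 0`, where the `m`-th root carries no information,
      -- among the finitely many exceptional terms.
      (Finset.range (N + 1) : Set ℕ).indicator (fun m => sawWeight φ ℓ m 1 * (X ^ m * K)) m +
        (b * X) ^ m * K := by
    intro m
    rcases lt_or_ge m (N + 1) with hm | hm
    · rw [Set.indicator_of_mem (by simpa using hm)]
      exact le_self_add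
    · refine le_trans ?_ le_add_self
      have hm0 : (m : ℝ) ≠ 0 := by
        have : 0 < m := by omega
        positivity
      have h1 : sawWeight φ ℓ m 1 ≤ b ^ m := by
        have h2 := ENNReal.rpow_le_rpow (hN m (by omega)).le (Nat.cast_nonneg (α := ℝ) m)
        rwa [← ENNReal.rpow_mul, one_div_mul_cancel hm0, ENNReal.rpow_one,
          ENNReal.rpow_natCast] at h2
      rw [mul_pow, mul_assoc]
      exact mul_le_mul_left h1 _
  refine ne_top_of_le_ne_top ?_ (ENNReal.tsum_le_tsum hterm)
  rw [ENNReal.tsum_add, ENNReal.tsum_mul_right, ENNReal.tsum_geometric, ← tsum_subtype,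
    Finset.tsum_subtype' (Finset.range (N + 1)) fun m : ℕ => sawWeight φ ℓ m 1 * (X ^ m * K)]
  refine ENNReal.add_ne_top.2 ⟨ENNReal.sum_ne_top.2 fun m _ => ENNReal.mul_ne_top (hW m)
    (ENNReal.mul_ne_top (ENNReal.pow_ne_top ENNReal.ofReal_ne_top) ENNReal.ofReal_ne_top),
    ENNReal.mul_ne_top ?_ ENNReal.ofReal_ne_top⟩
  rw [ENNReal.inv_ne_top]
  exact (tsub_pos_of_lt hbX).ne'

lemma totalWeight_length_le (f : Γ → ℝ≥0∞) (n : ℕ) :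
    totalWeight f {l | l.length = n} ≤ (∑' g, f g) ^ n := by
  induction n with
  | zero =>
    rw [pow_zero, ← listWeight_nil f, ← totalWeight_singleton]
    exact totalWeight_mono_set f fun l hl => List.length_eq_zero_iff.1 hl
  | succ n ih =>
    rw [pow_succ']
    refine (totalWeight_le_mul f _ {l | l.length = 1} (fun _ => {l | l.length = n}) _
      (fun l hl => ⟨1, ?_, ?_⟩) fun _ _ => ih).trans (mul_le_mul_left ?_ _)
    · simp [show l.length = n + 1 from hl]
    · simp [show l.length = n + 1 from hl]
    · rw [totalWeight_eq_tsum_subtype]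
      let e : {l : List Γ | l.length = 1} → Γ := fun l => l.1.prod
      have hsingle : ∀ l : {l : List Γ | l.length = 1}, l.1 = [e l] := fun l => by
        obtain ⟨g, hg⟩ := List.length_eq_one_iff.1 l.2
        simp [e, hg]
      have he : Function.Injective e := fun l l' h => Subtype.ext (by
        rw [hsingle l, hsingle l', h])
      refine le_trans (ENNReal.tsum_le_tsum fun l => ?_)
        (ENNReal.tsum_comp_le_tsum_of_injective he f)
      rw [hsingle l, listWeight_cons, listWeight_nil, mul_one]

/-- For small `x` the steps have total weight less than one, so even the series over all lists is
dominated by a geometric series. The exponent `c⁻¹` makes each factor `x ^ ℓ g` at most `r`. -/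
lemma exists_sawSeries_ne_top (h0 : ∀ g, 0 ≤ φ g) (hsum : Summable φ) {c : ℝ} (hc : 0 < c)
    (hℓ : ∀ g, c ≤ ℓ g) : ∃ x, 0 < x ∧ sawSeries φ ℓ x ≠ ∞ := by
  have hS : 0 ≤ ∑' g, φ g := tsum_nonneg h0
  set S := ∑' g, φ g
  set r : ℝ := 1 / (2 * (S + 1))
  have hr : 0 < r := by positivity
  have hr1 : r ≤ 1 := (div_le_one (by positivity)).2 (by linarith)
  have hrS : r * S < 1 := by
    rw [div_mul_eq_mul_div, div_lt_one (by positivity)]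
    linarith
  refine ⟨r ^ c⁻¹, Real.rpow_pos_of_pos hr _, ?_⟩
  have hx : 0 < r ^ c⁻¹ := Real.rpow_pos_of_pos hr _
  have hx1 : r ^ c⁻¹ ≤ 1 := Real.rpow_le_one hr.le hr1 (by positivity)
  have hf : ∑' g, stepWeight φ ℓ (r ^ c⁻¹) g ≤ ENNReal.ofReal (r * S) := by
    rw [← tsum_mul_left, ENNReal.ofReal_tsum_of_nonneg (fun g => mul_nonneg hr.le (h0 g))
      (hsum.mul_left r)]
    refine ENNReal.tsum_le_tsum fun g => ENNReal.ofReal_le_ofReal ?_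
    rw [mul_comm]
    refine mul_le_mul_of_nonneg_right ?_ (h0 g)
    calc (r ^ c⁻¹) ^ ℓ g ≤ (r ^ c⁻¹) ^ c := Real.rpow_le_rpow_of_exponent_ge hx hx1 (hℓ g)
      _ = r := Real.rpow_inv_rpow hr.le hc.ne'
  refine ne_top_of_le_ne_top ?_ (totalWeight_mono_set _ (Set.subset_univ _))
  rw [← tsum_totalWeight_fiber _ _ List.length]
  refine ne_top_of_le_ne_top ?_ (ENNReal.tsum_le_tsum fun n =>
    (totalWeight_mono_set _ fun l hl => hl.2).trans
      ((totalWeight_length_le _ n).trans (pow_le_pow_left' hf n)))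
  rw [ENNReal.tsum_geometric, ENNReal.inv_ne_top]
  exact (tsub_pos_of_lt (ENNReal.ofReal_lt_one.2 hrS)).ne'

lemma growthRate_ne_top (h0 : ∀ g, 0 ≤ φ g) (hsum : Summable φ) {c : ℝ} (hc : 0 < c)
    (hℓ : ∀ g, c ≤ ℓ g) : growthRate φ ℓ 1 ≠ ∞ := by
  obtain ⟨x, hx, hfin⟩ := exists_sawSeries_ne_top h0 hsum hc hℓ
  exact ne_top_of_le_ne_top ENNReal.ofReal_ne_top (growthRate_le h0 hx hfin 1)

/-- The generating function is finite strictly inside the radius of convergence. -/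
lemma sawSeries_ne_top_of_toReal_lt (h0 : ∀ g, 0 ≤ φ g) (hsum : Summable φ) {c : ℝ} (hc : 0 < c)
    (hℓ : ∀ g, c ≤ ℓ g) {a : ℝ} (ha : (growthRate φ ℓ 1).toReal < a) :
    sawSeries φ ℓ (1 / a) ≠ ∞ := by
  have ha0 : 0 < a := ENNReal.toReal_nonneg.trans_lt ha
  obtain ⟨x, hx, hfin⟩ := exists_sawSeries_ne_top h0 hsum hc hℓ
  refine sawSeries_ne_top_of_growthRate_lt h0 (fun g => hc.le.trans (hℓ g)) (by positivity)
    (fun m => sawWeight_ne_top h0 hx hfin _ _) ?_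
  rwa [one_div_one_div, ENNReal.lt_ofReal_iff_toReal_lt (growthRate_ne_top h0 hsum hc hℓ)]

/-- The connective constant exists and is the growth rate for `c = 1`. -/
lemma isConnectiveConstant_growthRate (h0 : ∀ g, 0 ≤ φ g) (hsum : Summable φ) {c : ℝ}
    (hc : 0 < c) (hℓ : ∀ g, c ≤ ℓ g) :
    IsConnectiveConstant φ ℓ (growthRate φ ℓ 1).toReal := by
  refine ⟨ENNReal.toReal_nonneg, ?_⟩
  filter_upwards [eventually_ge_atTop 1] with d hd
  change growthRate φ ℓ d = _
  refine le_antisymm ?_ ?_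
  -- Finiteness of the series at `1 / (R + ε)`, deduced from width `1`, bounds the growth for every
  -- width; this gives independence of the window.
  · refine ENNReal.le_of_forall_pos_le_add fun ε hε _ => ?_
    set R := (growthRate φ ℓ 1).toReal
    have hR : 0 ≤ R := ENNReal.toReal_nonneg
    have hε' : (0 : ℝ) < ε := hε
    have h1 : sawSeries φ ℓ (1 / (R + ε)) ≠ ∞ :=
      sawSeries_ne_top_of_toReal_lt h0 hsum hc hℓ (by linarith)
    have h2 := growthRate_le h0 (by positivity) h1 d
    rwa [one_div_one_div, ENNReal.ofReal_add hR hε'.le, ENNReal.ofReal_coe_nnreal] at h2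
  · rw [ENNReal.ofReal_toReal (growthRate_ne_top h0 hsum hc hℓ)]
    exact growthRate_mono h0 (fun _ => le_rfl) hd

end Growth

end IncrementList

/-! ### Continuity under truncation -/

/-- By normality, vertices in the same coset differ by left multiplication by an element of `H`,
which preserves height differences. -/
lemma IsStrongHeightFunction.isTypedHeight {Γ : Type*} [Group Γ] {G : SimpleGraph Γ}
    {H : Subgroup Γ} [H.Normal] {h : Γ → ℤ} (hh : IsStrongHeightFunction G H h) :
    IncrementList.IsTypedHeight h (QuotientGroup.mk' H) := by
  intro v w hvw g
  have h1 : v * w⁻¹ ∈ H := by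
    rw [← QuotientGroup.ker_mk' H, MonoidHom.mem_ker, map_mul, map_inv, hvw, mul_inv_cancel]
  have h2 := hh.diff_invariant _ h1 w (w * g)
  rwa [← mul_assoc, inv_mul_cancel_right] at h2

lemma IsWeightFunction.pos_of_adj {Γ : Type*} [Group Γ] {φ : Γ → ℝ} (hφ : IsWeightFunction φ)
    {u v : Γ} (huv : (supportGraph φ).Adj u v) : 0 < φ (u⁻¹ * v) := by
  rw [supportGraph, SimpleGraph.mulCayley_adj] at huv
  rcases huv.2 with h | h
  · exact h
  · rw [← hφ.symm]
    simpa using h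

open IncrementList in
lemma tendsto_growthRate_truncate {Γ : Type*} [Group Γ] {H : Subgroup Γ} {φ ℓ : Γ → ℝ}
    (hφ : IsWeightFunction φ) {h : Γ → ℤ} (hh : IsStrongHeightFunction (supportGraph φ) H h)
    (hℓs : ∀ g, ℓ g⁻¹ = ℓ g) {c : ℝ} (hc : 0 < c) (hℓ : ∀ g, c ≤ ℓ g) :
    Tendsto (fun η => (growthRate (truncate φ η) ℓ 1).toReal) (𝓝[>] 0)
      (𝓝 (growthRate φ ℓ 1).toReal) := by
  have := hh.normal
  have := hh.finiteIndex
  have h0 := hφ.nonneg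
  have hsum : ∀ η, Summable (truncate φ η) := fun η =>
    Summable.of_nonneg_of_le (truncate_nonneg h0 η) (truncate_le h0 η) hφ.summable
  have htop := growthRate_ne_top h0 hφ.summable hc hℓ
  have htop' : ∀ η, growthRate (truncate φ η) ℓ 1 ≠ ∞ := fun η =>
    growthRate_ne_top (truncate_nonneg h0 η) (hsum η) hc hℓ
  refine tendsto_order.2 ⟨fun a ha => ?_, fun a ha => Eventually.of_forall fun η =>
    (ENNReal.toReal_mono htop (growthRate_mono (truncate_nonneg h0 η) (truncate_le h0 η)
      le_rfl)).trans_lt ha⟩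
  rcases lt_or_ge a 0 with ha0 | ha0
  · exact Eventually.of_forall fun η => ha0.trans_le ENNReal.toReal_nonneg
  suffices hex : ∃ η₀, 0 < η₀ ∧ a < (growthRate (truncate φ η₀) ℓ 1).toReal by
    obtain ⟨η₀, hη₀, hlt⟩ := hex
    filter_upwards [Ioo_mem_nhdsGT hη₀] with η hη
    exact hlt.trans_le (ENNReal.toReal_mono (htop' η)
      (growthRate_mono (truncate_nonneg h0 η₀) (truncate_antitone h0 hη.2.le) le_rfl))
  by_contra! hle
  -- Two intermediate values are needed: `b` gives strict room for the truncated series to be finite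
  -- at `1 / b`, and `d` gives the loss in passing to the series of `φ` at `1 / d`.
  obtain ⟨b, hab, hb⟩ := exists_between ha
  obtain ⟨d, hbd, hd⟩ := exists_between hb
  have hb0 : 0 < b := ha0.trans_lt hab
  have hd0 : 0 < d := hb0.trans hbd
  have hup : ∀ v, ∃ g, 0 < φ g ∧ h v < h (v * g) := fun v => by
    obtain ⟨-, w, -, hw, -, hlt⟩ := hh.exists_neighbours v
    exact ⟨v⁻¹ * w, hφ.pos_of_adj hw, by rwa [mul_inv_cancel_left]⟩
  have hdown : ∀ v, ∃ g, 0 < φ g ∧ h (v * g) < h v := fun v => by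
    obtain ⟨u, -, hu, -, hlt, -⟩ := hh.exists_neighbours v
    exact ⟨v⁻¹ * u, hφ.pos_of_adj hu, by rwa [mul_inv_cancel_left]⟩
  have hfin : sawSeries φ ℓ (1 / d) ≠ ∞ := by
    refine sawSeries_ne_top_of_truncate hh.isTypedHeight (QuotientGroup.mk'_surjective H) h0
      hφ.symm hℓs hc hℓ (hφ.spans.exists_list h0) hup hdown (x := 1 / b) (by positivity)
      (one_div_lt_one_div_of_lt hb0 hbd) ?_
    filter_upwards [self_mem_nhdsWithin] with η hη
    exact sawSeries_ne_top_of_toReal_lt (truncate_nonneg h0 η) (hsum η) hc hℓ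
      ((hle η hη).trans_lt hab)
  have := ENNReal.toReal_mono ENNReal.ofReal_ne_top (growthRate_le h0 (by positivity) hfin 1)
  rw [one_div_one_div, ENNReal.toReal_ofReal hd0.le] at this
  exact hd.not_ge this

theorem proposition6p3 {Γ : Type*} [Group Γ] [Group.FG Γ]
    (H : Subgroup Γ) (F : H →* Multiplicative ℤ) (hF : IsVirtuallyIndicableBy H F)
    (φ ℓ : Γ → ℝ) (hφ : IsWeightFunction φ)
    (h : Γ → ℤ) (hh : IsStrongHeightFunction (supportGraph φ) H h)
    (C ε : ℝ) (hC : 0 < C) (hε₁ : 1 ≤ ε) (hε₂ : ε < 2)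
    (hℓ : IsHolderLengthFunction h ε C φ ℓ)
    (hcont : ContinuousAtZero φ ℓ) :
    ∃ (μ : ℝ) (M : ℝ) (μtrunc : ℝ → ℝ),
      IsConnectiveConstant φ ℓ μ ∧
      0 < M ∧
      (∀ η : ℝ, 0 < η → η < M →
        IsWeightFunction (truncate φ η) ∧ IsConnectiveConstant (truncate φ η) ℓ (μtrunc η)) ∧
      Tendsto μtrunc (𝓝[>] 0) (𝓝 μ) := by
  have hlen := hℓ.isLengthFunction
  have hle : ∀ g, ⨅ γ, ℓ γ ≤ ℓ g := fun g =>
    ciInf_le ⟨0, by rintro _ ⟨γ, rfl⟩; exact (hlen.pos γ).le⟩ g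
  obtain ⟨M, hM, htr⟩ := hφ.exists_truncate
  refine ⟨_, M, _, IncrementList.isConnectiveConstant_growthRate hφ.nonneg hφ.summable
    hlen.min_pos hle, hM, fun η h0 hη => ⟨htr η h0 hη, ?_⟩,
    tendsto_growthRate_truncate hφ hh hlen.symm hlen.min_pos hle⟩
  exact IncrementList.isConnectiveConstant_growthRate (htr η h0 hη).nonneg (htr η h0 hη).summable
    hlen.min_pos hle
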